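/- Let $k$ be a field. An algebra is an associative, not necessarily unital $k$-algebra; $\otimes=\otimes_k$. An algebra $A$ is *non-degenerate* if $a=0$ whenever $ab=0$ for all $b\in A$ or $ba=0$ for all $b\in A$, and *idempotent* if every element is a finite sum of products of two elements. The multiplier algebra $\mathbb M(A)$ consists of the pairs $x=(\lambda,\rho)$ of a right $A$-linear map $\lambda:A\to A$ and a left $A$-linear map $\rho:A\to A$ (both $k$-linear) with $a\lambda(b)=\rho(a)b$ for all $a,b\in A$; its product is $(\lambda,\rho)(\lambda',\rho')=(\lambda\circ\lambda',\rho'\circ\rho)$, its unit is $(\mathrm{id},\mathrm{id})$, and one writes $x\rhd a=\lambda(a)$, $a\lhd x=\rho(a)$. Let $\iota_A:A\to\mathbb M(A)$ send $a$ to the pair of left and right multiplication by $a$, and let $\Psi:\mathbb M(A)\otimes\mathbb M(B)\to\mathbb M(A\otimes B)$ be the canonical algebra map; one writes $x\otimes y$ for $\Psi(x\otimes y)$ and suppresses $\iota$ in such expressions. The monoidal category $\mathsf{NdI}_k$ has as objects the non-degenerate idempotent algebras, and as morphisms from $B$ to $A$ the algebra maps $f:B\to\mathbb M(A)$ such that $f(B)\rhd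 A=A=A\lhd f(B)$ (linear spans). Such an $f$ extends uniquely to a unital algebra map $\bar f:\mathbb M(B)\to\mathbb M(A)$ with $\bar f\circ\iota_B=f$. The composite of $f:B\to\mathbb M(A)$ and $g:A\to\mathbb M(R)$ is $\bar g\circ f$, the identity of $A$ is $\iota_A$, the tensor product of morphisms $f,f'$ is $\Psi\circ(f\otimes f')$, the unit object is $k$, and the constraints are induced by those of $k$-vector spaces. A *multiplier bialgebra* is a comonoid in $\mathsf{NdI}_k$. A *multiplier Hopf algebra* is a non-degenerate algebra $A$ with an algebra map $\Delta:A\to\mathbb M(A\otimes A)$ such that $\Delta(a)(1\otimes b)$ and $(a\otimes1)\Delta(b)$ lie in $\iota_{A\otimes A}(A\otimes A)$ for all $a,b\in A$; such that $\Delta$ is coassociative, i.e. for all $a,b,c\in A$, in $\mathbb M(A\otimes A\otimes A)$, $$(a\otimes1\otimes1)\,(\Delta\otimes A)\big(\Delta(b)(1\otimes c)\big)=(A\otimes\Delta)\big((a\otimes1)\Delta(b)\big)\,(1\otimes1\otimes c),$$ where $\Delta\otimes A$ and $A\otimes\Delta$ denote the maps $\Psi\circ(\Delta\otimes\iota_A)$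 and $\Psi\circ(\iota_A\otimes\Delta)$ on $A\otimes A\cong\iota_{A\otimes A}(A\otimes A)$; and such that the linear maps $T_1,T_2:A\otimes A\to A\otimes A$ determined by $\iota_{A\otimes A}(T_1(a\otimes b))=\Delta(a)(1\otimes b)$ and $\iota_{A\otimes A}(T_2(a\otimes b))=(a\otimes1)\Delta(b)$ are bijective. **Proposition.** Every non-zero multiplier Hopf algebra $(A,\Delta)$ over $k$ is a multiplier bialgebra: the algebra $A$ is idempotent, and there is a comonoid structure on the object $A$ of $\mathsf{NdI}_k$ whose comultiplication is given by the algebra map $\Delta:A\to\mathbb M(A\otimes A)$. -/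

import Mathlib

open scoped TensorProduct
open CategoryTheory

universe u

set_option linter.unusedSectionVars false
set_option linter.ambiguousOpen false

namespace MultHopf

/-! ### Non-degenerate, idempotent algebras -/

section Algebras

variable (k : Type*) [CommRing k]
variable (A : Type*) [NonUnitalRing A] [Module k A] [IsScalarTower k A A] [SMulCommClass k A A]

/-- A (not necessarily unital) algebra is non-degenerate if its product is non-degenerate
in each of the two variables. -/
class Nondegenerate (A : Type*) [NonUnitalRing A] : Prop where
  eq_zero_of_mul_right : ∀ a : A, (∀ b, a * b = 0) → a = 0
  eq_zero_of_mul_left : ∀ a : A, (∀ b, b * a = 0) → a = 0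

/-- An algebra is idempotent if every element is a finite sum of products of two elements, that is,
if the multiplication map `A ⊗ A → A` is surjective. -/
class Idempotent : Prop where
  mul_surjective : Function.Surjective (LinearMap.mul' k A)

end Algebras

section Algebras2
variable {k : Type*} [CommRing k]

/-- The linear forms on the projective module `P` separate the elements of `P ⊗ N`. -/
theorem eq_zero_of_rTensor_dual {P N : Type*} [AddCommGroup P] [Module k P] [AddCommGroup N]
    [Module k N] [Module.Projective k P] (x : P ⊗[k] N)
    (h : ∀ φ : P →ₗ[k] k, φ.rTensor N x = 0) : x = 0 := by
  obtain ⟨s, hs⟩ := Module.projective_def'.1 ‹Module.Projective k P›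
  classical
  have h1 : s.rTensor N x = 0 := by
    apply (TensorProduct.finsuppScalarLeft k N P).injective
    rw [map_zero]
    ext p
    have h2 := h (Finsupp.lapply p ∘ₗ s)
    rw [LinearMap.rTensor_comp, LinearMap.comp_apply] at h2
    rw [TensorProduct.finsuppScalarLeft_apply, h2]; simp
  have h4 : (Finsupp.linearCombination k id ∘ₗ s).rTensor N x = 0 := by
    rw [LinearMap.rTensor_comp, LinearMap.comp_apply, h1, map_zero]
  rwa [hs, LinearMap.rTensor_id, LinearMap.id_apply] at h4

theorem eq_zero_of_lTensor_dual {P N : Type*} [AddCommGroup P] [Module k P] [AddCommGroup N]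
    [Module k N] [Module.Projective k P] (x : N ⊗[k] P)
    (h : ∀ φ : P →ₗ[k] k, φ.lTensor N x = 0) : x = 0 := by
  apply (TensorProduct.comm k N P).injective
  rw [map_zero]
  refine eq_zero_of_rTensor_dual _ fun φ => ?_
  have : ∀ y : N ⊗[k] P, φ.rTensor N (TensorProduct.comm k N P y) =
      TensorProduct.comm k N k (φ.lTensor N y) := by
    intro y
    induction y with
    | zero => simp
    | add y z hy hz => simp [hy, hz]
    | tmul f n => simp
  rw [this, h, map_zero]

/-- If two families of endomorphisms are each jointly injective, then so is the family of their
tensor products. -/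
theorem eq_zero_of_map_eq_zero {P Q I J : Type*} [AddCommGroup P] [Module k P]
    [Module.Projective k P] [AddCommGroup Q] [Module k Q] [Module.Projective k Q]
    (f : I → P →ₗ[k] P) (g : J → Q →ₗ[k] Q)
    (hf : ∀ p, (∀ i, f i p = 0) → p = 0) (hg : ∀ q, (∀ j, g j q = 0) → q = 0)
    (x : P ⊗[k] Q) (h : ∀ i j, TensorProduct.map (f i) (g j) x = 0) : x = 0 := by
  have key : ∀ i, (f i).rTensor Q x = 0 := by
    intro i
    refine eq_zero_of_rTensor_dual _ fun φ => ?_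
    apply (TensorProduct.lid k Q).injective
    rw [map_zero]
    refine hg _ fun j => ?_
    have : ∀ y : P ⊗[k] Q, g j (TensorProduct.lid k Q (φ.rTensor Q ((f i).rTensor Q y))) =
        TensorProduct.lid k Q (φ.rTensor Q (TensorProduct.map (f i) (g j) y)) := by
      intro y
      induction y with
      | zero => simp
      | add y z hy hz => simp only [map_add, hy, hz]
      | tmul f n => simp
    rw [this, h]; simp
  refine eq_zero_of_lTensor_dual _ fun φ => ?_
  apply (TensorProduct.rid k P).injective
  rw [map_zero]
  refine hf _ fun i => ?_
  have : ∀ y : P ⊗[k] Q, f i (TensorProduct.rid k P (φ.lTensor P y)) =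
      TensorProduct.rid k P (φ.lTensor P ((f i).rTensor Q y)) := by
    intro y
    induction y with
    | zero => simp
    | add y z hy hz => simp only [map_add, hy, hz]
    | tmul f n => simp
  rw [this, key]; simp

variable {A : Type*} [NonUnitalRing A] [Module k A] [IsScalarTower k A A] [SMulCommClass k A A]
variable {B : Type*} [NonUnitalRing B] [Module k B] [IsScalarTower k B B] [SMulCommClass k B B]

instance Nondegenerate.tensor [Nondegenerate A] [Nondegenerate B] [Module.Projective k A]
    [Module.Projective k B] : Nondegenerate (A ⊗[k] B) where
  eq_zero_of_mul_right x h := by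
    refine eq_zero_of_map_eq_zero (fun a : A => (LinearMap.mul k A).flip a)
      (fun b : B => (LinearMap.mul k B).flip b)
      (fun p hp => Nondegenerate.eq_zero_of_mul_right p hp)
      (fun q hq => Nondegenerate.eq_zero_of_mul_right q hq) x fun a b => ?_
    have : ∀ y : A ⊗[k] B, TensorProduct.map ((LinearMap.mul k A).flip a)
        ((LinearMap.mul k B).flip b) y = y * (a ⊗ₜ b) := by
      intro y
      induction y with
      | zero => simp
      | add y z hy hz => rw [map_add, add_mul, hy, hz]
      | tmul f n => simp
    exact (this x).trans (h _)
  eq_zero_of_mul_left x h := by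
    refine eq_zero_of_map_eq_zero (fun a : A => LinearMap.mul k A a)
      (fun b : B => LinearMap.mul k B b)
      (fun p hp => Nondegenerate.eq_zero_of_mul_left p hp)
      (fun q hq => Nondegenerate.eq_zero_of_mul_left q hq) x fun a b => ?_
    have : ∀ y : A ⊗[k] B, TensorProduct.map (LinearMap.mul k A a)
        (LinearMap.mul k B b) y = (a ⊗ₜ b) * y := by
      intro y
      induction y with
      | zero => simp
      | add y z hy hz => rw [map_add, mul_add, hy, hz]
      | tmul f n => simp
    exact (this x).trans (h _)

instance Idempotent.tensor [Idempotent k A] [Idempotent k B] : Idempotent k (A ⊗[k] B) where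
  mul_surjective := by
    have h : LinearMap.mul' k (A ⊗[k] B) =
        TensorProduct.map (LinearMap.mul' k A) (LinearMap.mul' k B) ∘ₗ
          (TensorProduct.tensorTensorTensorComm k A B A B).toLinearMap := by
      ext a b c d; simp
    rw [h, LinearMap.coe_comp]
    exact (TensorProduct.map_surjective Idempotent.mul_surjective
      Idempotent.mul_surjective).comp (LinearEquiv.surjective _)

instance Nondegenerate.base (R : Type*) [CommRing R] : Nondegenerate R where
  eq_zero_of_mul_right a h := by simpa using h 1
  eq_zero_of_mul_left a h := by simpa using h 1

instance Idempotent.base : Idempotent k k where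
  mul_surjective a := ⟨a ⊗ₜ 1, by simp⟩

end Algebras2

/-! ### The multiplier algebra -/

section Multipliers

variable (k : Type*) [CommRing k]
variable (A : Type*) [NonUnitalRing A] [Module k A] [IsScalarTower k A A] [SMulCommClass k A A]

/-- The multipliers of `A`: all pairs `(l, r)` of a right `A`-linear map `l : A → A` and a
left `A`-linear map `r : A → A` (both linear over `k`) with `a * l b = r a * b` for all `a`, `b`.
The product is `(l, r) (l', r') = (l ∘ l', r' ∘ r)` and the unit is `(id, id)`. -/
def multiplierSubalgebra : Subalgebra k (Module.End k A × (Module.End k A)ᵐᵒᵖ) where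
  carrier := {x | (∀ a b, x.1 (a * b) = x.1 a * b) ∧
    (∀ a b, x.2.unop (a * b) = a * x.2.unop b) ∧ ∀ a b, a * x.1 b = x.2.unop a * b}
  mul_mem' := by
    rintro x y ⟨hx₁, hx₂, hx₃⟩ ⟨hy₁, hy₂, hy₃⟩
    refine ⟨fun a b => ?_, fun a b => ?_, fun a b => ?_⟩
    · simp [hx₁, hy₁]
    · simp [hx₂, hy₂]
    · simp [hx₃, hy₃]
  add_mem' := by
    rintro x y ⟨hx₁, hx₂, hx₃⟩ ⟨hy₁, hy₂, hy₃⟩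
    refine ⟨fun a b => ?_, fun a b => ?_, fun a b => ?_⟩
    · simp [hx₁, hy₁, add_mul]
    · simp [hx₂, hy₂, mul_add]
    · simp [hx₃, hy₃, add_mul, mul_add]
  algebraMap_mem' c := by
    refine ⟨fun a b => ?_, fun a b => ?_, fun a b => ?_⟩
    · simp [Module.algebraMap_end_apply, smul_mul_assoc]
    · simp [Module.algebraMap_end_apply, mul_smul_comm]
    · simp [Module.algebraMap_end_apply, smul_mul_assoc, mul_smul_comm]

/-- The multiplier algebra `𝕄(A)`. -/
def MultiplierAlgebra : Type _ := multiplierSubalgebra k A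

instance : Ring (MultiplierAlgebra k A) := inferInstanceAs (Ring (multiplierSubalgebra k A))

instance : Algebra k (MultiplierAlgebra k A) :=
  inferInstanceAs (Algebra k (multiplierSubalgebra k A))

variable {k A}

/-- The left action `x ▹ a` of a multiplier `x = (l, r)`, that is, `l a`. -/
def MultiplierAlgebra.left (x : MultiplierAlgebra k A) : A →ₗ[k] A := x.1.1

/-- The right action `a ◃ x` of a multiplier `x = (l, r)`, that is, `r a`. -/
def MultiplierAlgebra.right (x : MultiplierAlgebra k A) : A →ₗ[k] A := x.1.2.unop

namespace MultiplierAlgebra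

theorem left_apply_mul (x : MultiplierAlgebra k A) (a b : A) :
    x.left (a * b) = x.left a * b := x.2.1 a b

theorem right_apply_mul (x : MultiplierAlgebra k A) (a b : A) :
    x.right (a * b) = a * x.right b := x.2.2.1 a b

theorem mul_left_apply (x : MultiplierAlgebra k A) (a b : A) :
    a * x.left b = x.right a * b := x.2.2.2 a b

/-- The multiplier given by a compatible pair. -/
def mk (l r : A →ₗ[k] A) (hl : ∀ a b, l (a * b) = l a * b) (hr : ∀ a b, r (a * b) = a * r b)
    (h : ∀ a b, a * l b = r a * b) : MultiplierAlgebra k A :=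
  ⟨(l, MulOpposite.op r), hl, hr, h⟩

@[simp] theorem left_mk (l r : A →ₗ[k] A) (hl hr h) : (mk l r hl hr h).left = l := rfl
@[simp] theorem right_mk (l r : A →ₗ[k] A) (hl hr h) : (mk l r hl hr h).right = r := rfl

@[ext] theorem ext {x y : MultiplierAlgebra k A} (hl : ∀ a, x.left a = y.left a)
    (hr : ∀ a, x.right a = y.right a) : x = y :=
  Subtype.ext (Prod.ext (LinearMap.ext hl) (MulOpposite.unop_injective (LinearMap.ext hr)))

@[simp] theorem left_mul (x y : MultiplierAlgebra k A) (a : A) :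
    (x * y).left a = x.left (y.left a) := rfl
@[simp] theorem right_mul (x y : MultiplierAlgebra k A) (a : A) :
    (x * y).right a = y.right (x.right a) := rfl
@[simp] theorem left_one (a : A) : (1 : MultiplierAlgebra k A).left a = a := rfl
@[simp] theorem right_one (a : A) : (1 : MultiplierAlgebra k A).right a = a := rfl
@[simp] theorem left_add (x y : MultiplierAlgebra k A) (a : A) :
    (x + y).left a = x.left a + y.left a := rfl
@[simp] theorem right_add (x y : MultiplierAlgebra k A) (a : A) :
    (x + y).right a = x.right a + y.right a := rfl
@[simp] theorem left_zero (a : A) : (0 : MultiplierAlgebra k A).left a = 0 := rfl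
@[simp] theorem right_zero (a : A) : (0 : MultiplierAlgebra k A).right a = 0 := rfl
@[simp] theorem left_smul (c : k) (x : MultiplierAlgebra k A) (a : A) :
    (c • x).left a = c • x.left a := rfl
@[simp] theorem right_smul (c : k) (x : MultiplierAlgebra k A) (a : A) :
    (c • x).right a = c • x.right a := rfl

/-- Over a non-degenerate algebra, a multiplier is determined by its left action. -/
theorem ext_left [Nondegenerate A] {x y : MultiplierAlgebra k A}
    (hl : ∀ a, x.left a = y.left a) : x = y := by
  refine ext hl fun a => sub_eq_zero.1 (Nondegenerate.eq_zero_of_mul_right _ fun b => ?_)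
  rw [sub_mul, ← mul_left_apply, ← mul_left_apply, hl, sub_self]

variable (k A) in
/-- The canonical map `ι : A → 𝕄(A)` sending `a` to (left, right) multiplication by `a`. -/
def ι : A →ₙₐ[k] MultiplierAlgebra k A where
  toFun a := mk (LinearMap.mulLeft k a) (LinearMap.mulRight k a)
    (by simp [mul_assoc]) (by simp [mul_assoc]) (by simp [mul_assoc])
  map_smul' c a := ext (fun b => smul_mul_assoc c a b) (fun b => mul_smul_comm c b a)
  map_zero' := ext (fun b => zero_mul b) (fun b => mul_zero b)
  map_add' a b := ext (fun c => add_mul a b c) (fun c => mul_add c a b)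
  map_mul' a b := ext (fun c => mul_assoc a b c) (fun c => (mul_assoc c a b).symm)

@[simp] theorem left_ι (a b : A) : (ι k A a).left b = a * b := rfl
@[simp] theorem right_ι (a b : A) : (ι k A a).right b = b * a := rfl

theorem ι_injective [Nondegenerate A] : Function.Injective (ι k A) := by
  intro a b h
  refine sub_eq_zero.1 (Nondegenerate.eq_zero_of_mul_right _ fun c => ?_)
  rw [sub_mul, ← left_ι (k := k), ← left_ι (k := k), h, sub_self]

variable (k A) in
/-- The left action as a linear map. -/
def leftHom : MultiplierAlgebra k A →ₗ[k] A →ₗ[k] A where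
  toFun := left
  map_add' _ _ := rfl
  map_smul' _ _ := rfl

variable (k A) in
/-- The right action as a linear map. -/
def rightHom : MultiplierAlgebra k A →ₗ[k] A →ₗ[k] A where
  toFun := right
  map_add' _ _ := rfl
  map_smul' _ _ := rfl

@[simp] theorem leftHom_apply (x : MultiplierAlgebra k A) (a : A) :
    leftHom k A x a = x.left a := rfl
@[simp] theorem rightHom_apply (x : MultiplierAlgebra k A) (a : A) :
    rightHom k A x a = x.right a := rfl

variable {B : Type*} [NonUnitalRing B] [Module k B] [IsScalarTower k B B] [SMulCommClass k B B]

/-- The isomorphism `𝕄(A) → 𝕄(B)` induced by an algebra isomorphism `e : A → B`. -/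
def transport (e : A ≃ₗ[k] B) (he : ∀ a a', e (a * a') = e a * e a') (x : MultiplierAlgebra k A) :
    MultiplierAlgebra k B :=
  mk (e.toLinearMap ∘ₗ x.left ∘ₗ e.symm.toLinearMap) (e.toLinearMap ∘ₗ x.right ∘ₗ e.symm.toLinearMap)
    (fun b b' => by
      obtain ⟨a, rfl⟩ := e.surjective b
      obtain ⟨a', rfl⟩ := e.surjective b'
      simp [← he, left_apply_mul])
    (fun b b' => by
      obtain ⟨a, rfl⟩ := e.surjective b
      obtain ⟨a', rfl⟩ := e.surjective b'
      simp [← he, right_apply_mul])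
    (fun b b' => by
      obtain ⟨a, rfl⟩ := e.surjective b
      obtain ⟨a', rfl⟩ := e.surjective b'
      simp [← he, mul_left_apply])

variable (k A B) in
/-- The canonical map `Ψ : 𝕄(A) ⊗ 𝕄(B) → 𝕄(A ⊗ B)`, given by
`Ψ(x ⊗ y) ▹ (a ⊗ b) = (x ▹ a) ⊗ (y ▹ b)` and `(a ⊗ b) ◃ Ψ(x ⊗ y) = (a ◃ x) ⊗ (b ◃ y)`. -/
noncomputable def Ψ :
    MultiplierAlgebra k A ⊗[k] MultiplierAlgebra k B →ₐ[k] MultiplierAlgebra k (A ⊗[k] B) :=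
  Algebra.TensorProduct.algHomOfLinearMapTensorProduct
    (TensorProduct.lift (LinearMap.mk₂ k
      (fun x y => mk (TensorProduct.map x.left y.left) (TensorProduct.map x.right y.right)
        (fun a b => by
          induction a with
          | zero => simp
          | add a a' h h' => simp [add_mul, h, h']
          | tmul a a' =>
            induction b with
            | zero => simp
            | add b b' h h' => simp [mul_add, h, h']
            | tmul b b' => simp [left_apply_mul])
        (fun a b => by
          induction a with
          | zero => simp
          | add a a' h h' => simp [add_mul, h, h']
          | tmul a a' =>
            induction b with
            | zero => simp
            | add b b' h h' => simp [mul_add, h, h']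
            | tmul b b' => simp [right_apply_mul])
        (fun a b => by
          induction a with
          | zero => simp
          | add a a' h h' => simp [add_mul, h, h']
          | tmul a a' =>
            induction b with
            | zero => simp
            | add b b' h h' => simp [mul_add, h, h']
            | tmul b b' => simp [mul_left_apply]))
      (fun x x' y => ext
        (fun a => LinearMap.congr_fun (TensorProduct.map_add_left x.left x'.left y.left) a)
        (fun a => LinearMap.congr_fun (TensorProduct.map_add_left x.right x'.right y.right) a))
      (fun c x y => ext
        (fun a => LinearMap.congr_fun (TensorProduct.map_smul_left c x.left y.left) a)
        (fun a => LinearMap.congr_fun (TensorProduct.map_smul_left c x.right y.right) a))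
      (fun x y y' => ext
        (fun a => LinearMap.congr_fun (TensorProduct.map_add_right x.left y.left y'.left) a)
        (fun a => LinearMap.congr_fun (TensorProduct.map_add_right x.right y.right y'.right) a))
      (fun c x y => ext
        (fun a => LinearMap.congr_fun (TensorProduct.map_smul_right c x.left y.left) a)
        (fun a => LinearMap.congr_fun (TensorProduct.map_smul_right c x.right y.right) a))))
    (fun x x' y y' => ext
      (fun a => LinearMap.congr_fun (TensorProduct.map_comp x.left y.left x'.left y'.left) a)
      (fun a => LinearMap.congr_fun (TensorProduct.map_comp x'.right y'.right x.right y.right) a))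
    (ext (fun a => LinearMap.congr_fun TensorProduct.map_id a)
      (fun a => LinearMap.congr_fun TensorProduct.map_id a))

theorem left_Ψ (x : MultiplierAlgebra k A) (y : MultiplierAlgebra k B) :
    (Ψ k A B (x ⊗ₜ y)).left = TensorProduct.map x.left y.left := rfl
theorem right_Ψ (x : MultiplierAlgebra k A) (y : MultiplierAlgebra k B) :
    (Ψ k A B (x ⊗ₜ y)).right = TensorProduct.map x.right y.right := rfl
@[simp] theorem left_Ψ_tmul (x : MultiplierAlgebra k A) (y : MultiplierAlgebra k B) (a : A)
    (b : B) : (Ψ k A B (x ⊗ₜ y)).left (a ⊗ₜ b) = x.left a ⊗ₜ y.left b := rfl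
@[simp] theorem right_Ψ_tmul (x : MultiplierAlgebra k A) (y : MultiplierAlgebra k B) (a : A)
    (b : B) : (Ψ k A B (x ⊗ₜ y)).right (a ⊗ₜ b) = x.right a ⊗ₜ y.right b := rfl

end MultiplierAlgebra

end Multipliers

/-! ### Non-degenerate algebra maps into multiplier algebras -/

section NondegenerateMaps

open MultiplierAlgebra

variable {k : Type*} [CommRing k]
variable {A : Type*} [NonUnitalRing A] [Module k A] [IsScalarTower k A A] [SMulCommClass k A A]
variable {B : Type*} [NonUnitalRing B] [Module k B] [IsScalarTower k B B] [SMulCommClass k B B]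
variable {C : Type*} [NonUnitalRing C] [Module k C] [IsScalarTower k C C] [SMulCommClass k C C]
variable {D : Type*} [NonUnitalRing D] [Module k D] [IsScalarTower k D D] [SMulCommClass k D D]

/-- The left `B`-action `B ⊗ A → A`, `b ⊗ a ↦ f b ▹ a`, induced by `f : B → 𝕄(A)`. -/
noncomputable def leftAct (f : B →ₙₐ[k] MultiplierAlgebra k A) : B ⊗[k] A →ₗ[k] A :=
  TensorProduct.lift (leftHom k A ∘ₗ (f : B →ₗ[k] MultiplierAlgebra k A))

/-- The right `B`-action `A ⊗ B → A`, `a ⊗ b ↦ a ◃ f b`, induced by `f : B → 𝕄(A)`. -/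
noncomputable def rightAct (f : B →ₙₐ[k] MultiplierAlgebra k A) : A ⊗[k] B →ₗ[k] A :=
  TensorProduct.lift (rightHom k A ∘ₗ (f : B →ₗ[k] MultiplierAlgebra k A)).flip

@[simp] theorem leftAct_tmul (f : B →ₙₐ[k] MultiplierAlgebra k A) (b : B) (a : A) :
    leftAct f (b ⊗ₜ a) = (f b).left a := rfl
@[simp] theorem rightAct_tmul (f : B →ₙₐ[k] MultiplierAlgebra k A) (b : B) (a : A) :
    rightAct f (a ⊗ₜ b) = (f b).right a := rfl

/-- An algebra map `f : B → 𝕄(A)` makes `A` an extension of `B`. It is called non-degenerate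
if `A` is idempotent as a `B`-bimodule: `f(B) ▹ A = A = A ◃ f(B)`. -/
structure IsNondegenerateMap (f : B →ₙₐ[k] MultiplierAlgebra k A) : Prop where
  left_surjective : Function.Surjective (leftAct f)
  right_surjective : Function.Surjective (rightAct f)

namespace IsNondegenerateMap

variable {f : B →ₙₐ[k] MultiplierAlgebra k A}

theorem left_induction (hf : IsNondegenerateMap f) {p : A → Prop} (h0 : p 0) (hadd : ∀ a a', p a → p a' → p (a + a'))
    (h : ∀ b a, p ((f b).left a)) (a : A) : p a := by
  obtain ⟨t, rfl⟩ := hf.left_surjective a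
  induction t with
  | zero => simpa using h0
  | add x y hx hy => rw [map_add]; exact hadd _ _ hx hy
  | tmul b a => exact h b a

theorem right_induction (hf : IsNondegenerateMap f) {p : A → Prop} (h0 : p 0) (hadd : ∀ a a', p a → p a' → p (a + a'))
    (h : ∀ b a, p ((f b).right a)) (a : A) : p a := by
  obtain ⟨t, rfl⟩ := hf.right_surjective a
  induction t with
  | zero => simpa using h0
  | add x y hx hy => rw [map_add]; exact hadd _ _ hx hy
  | tmul a b => exact h b a

/-- If `A` is a non-degenerate algebra that is idempotent as a `B`-bimodule, then it is also
non-degenerate as a right and as a left `B`-module. -/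
theorem nondegenerate_bimodule (hf : IsNondegenerateMap f) [Nondegenerate A] (a : A) :
    ((∀ b, (f b).right a = 0) → a = 0) ∧ ((∀ b, (f b).left a = 0) → a = 0) := by
  refine ⟨fun h => Nondegenerate.eq_zero_of_mul_right a fun c => ?_,
    fun h => Nondegenerate.eq_zero_of_mul_left a fun c => ?_⟩
  · refine hf.left_induction (p := fun c => a * c = 0) (mul_zero a) ?_ ?_ c
    · intro c c' hc hc'; rw [mul_add, hc, hc', add_zero]
    · intro b c; rw [mul_left_apply, h, zero_mul]
  · refine hf.right_induction (p := fun c => c * a = 0) (zero_mul a) ?_ ?_ c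
    · intro c c' hc hc'; rw [add_mul, hc, hc', add_zero]
    · intro b c; rw [← mul_left_apply, h, mul_zero]

theorem left_leftAct_rTensor (x : MultiplierAlgebra k B) (b : B) (t : B ⊗[k] A) :
    (f b).left (leftAct f (x.left.rTensor A t)) = (f (x.right b)).left (leftAct f t) := by
  induction t with
  | zero => simp
  | add t t' h h' => simp only [map_add, h, h']
  | tmul c a => simp [← left_mul, ← map_mul, mul_left_apply]

theorem right_rightAct_lTensor (x : MultiplierAlgebra k B) (b : B) (t : A ⊗[k] B) :
    (f b).right (rightAct f (x.right.lTensor A t)) = (f (x.left b)).right (rightAct f t) := by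
  induction t with
  | zero => simp
  | add t t' h h' => simp only [map_add, h, h']
  | tmul c a => simp [← right_mul, ← map_mul, mul_left_apply]

theorem ker_left (hf : IsNondegenerateMap f) [Nondegenerate A] (x : MultiplierAlgebra k B) :
    LinearMap.ker (leftAct f) ≤ LinearMap.ker (leftAct f ∘ₗ x.left.rTensor A) := by
  intro t ht
  refine (hf.nondegenerate_bimodule _).2 fun b => ?_
  rw [LinearMap.comp_apply, left_leftAct_rTensor, LinearMap.mem_ker.1 ht, map_zero]

theorem ker_right (hf : IsNondegenerateMap f) [Nondegenerate A] (x : MultiplierAlgebra k B) :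
    LinearMap.ker (rightAct f) ≤ LinearMap.ker (rightAct f ∘ₗ x.right.lTensor A) := by
  intro t ht
  refine (hf.nondegenerate_bimodule _).1 fun b => ?_
  rw [LinearMap.comp_apply, right_rightAct_lTensor, LinearMap.mem_ker.1 ht, map_zero]

/-- The left part of `f̄ x`, determined by `f b ▹ a ↦ f (x ▹ b) ▹ a`. -/
noncomputable def extendLeft (hf : IsNondegenerateMap f) [Nondegenerate A] (x : MultiplierAlgebra k B) : A →ₗ[k] A :=
  (LinearMap.ker (leftAct f)).liftQ _ (hf.ker_left x) ∘ₗ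
    ((leftAct f).quotKerEquivOfSurjective hf.left_surjective).symm.toLinearMap

/-- The right part of `f̄ x`, determined by `a ◃ f b ↦ a ◃ f (b ◃ x)`. -/
noncomputable def extendRight (hf : IsNondegenerateMap f) [Nondegenerate A] (x : MultiplierAlgebra k B) : A →ₗ[k] A :=
  (LinearMap.ker (rightAct f)).liftQ _ (hf.ker_right x) ∘ₗ
    ((rightAct f).quotKerEquivOfSurjective hf.right_surjective).symm.toLinearMap

theorem extendLeft_apply (hf : IsNondegenerateMap f) [Nondegenerate A] (x : MultiplierAlgebra k B) (b : B) (a : A) :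
    hf.extendLeft x ((f b).left a) = (f (x.left b)).left a := by
  have h : ((leftAct f).quotKerEquivOfSurjective hf.left_surjective).symm ((f b).left a) =
      Submodule.Quotient.mk (b ⊗ₜ a) := by
    rw [LinearEquiv.symm_apply_eq]; rfl
  rw [extendLeft, LinearMap.comp_apply, LinearEquiv.coe_coe, h]
  simp

theorem extendRight_apply (hf : IsNondegenerateMap f) [Nondegenerate A] (x : MultiplierAlgebra k B) (b : B) (a : A) :
    hf.extendRight x ((f b).right a) = (f (x.right b)).right a := by
  have h : ((rightAct f).quotKerEquivOfSurjective hf.right_surjective).symm ((f b).right a) =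
      Submodule.Quotient.mk (a ⊗ₜ b) := by
    rw [LinearEquiv.symm_apply_eq]; rfl
  rw [extendRight, LinearMap.comp_apply, LinearEquiv.coe_coe, h]
  simp

/-- The multiplier `f̄ x`. -/
noncomputable def extendFun (hf : IsNondegenerateMap f) [Nondegenerate A] (x : MultiplierAlgebra k B) :
    MultiplierAlgebra k A :=
  MultiplierAlgebra.mk (hf.extendLeft x) (hf.extendRight x)
    (fun a c => by
      refine hf.left_induction (p := fun a => hf.extendLeft x (a * c) = hf.extendLeft x a * c)
        (by simp) (fun a a' h h' => by rw [add_mul, map_add, map_add, add_mul, h, h']) ?_ a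
      intro b a
      rw [← left_apply_mul, extendLeft_apply, extendLeft_apply, left_apply_mul])
    (fun c a => by
      refine hf.right_induction (p := fun a => hf.extendRight x (c * a) = c * hf.extendRight x a)
        (by simp) (fun a a' h h' => by rw [mul_add, map_add, map_add, mul_add, h, h']) ?_ a
      intro b a
      rw [← right_apply_mul, extendRight_apply, extendRight_apply, right_apply_mul])
    (fun a c => by
      refine hf.right_induction (p := fun a => a * hf.extendLeft x c = hf.extendRight x a * c)
        (by simp) (fun a a' h h' => by rw [add_mul, map_add, add_mul, h, h']) ?_ a
      intro b a
      refine hf.left_induction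
        (p := fun c => (f b).right a * hf.extendLeft x c = hf.extendRight x ((f b).right a) * c)
        (by simp) (fun a a' h h' => by rw [mul_add, map_add, mul_add, h, h']) ?_ c
      intro b' c
      rw [extendLeft_apply, extendRight_apply, ← mul_left_apply, ← mul_left_apply, ← left_mul,
        ← left_mul, ← map_mul, ← map_mul, mul_left_apply x])

/-- Two multipliers agreeing on the left on all `f b ▹ a` agree. -/
theorem ext_left (hf : IsNondegenerateMap f) [Nondegenerate A] {x y : MultiplierAlgebra k A}
    (h : ∀ b a, x.left ((f b).left a) = y.left ((f b).left a)) : x = y := by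
  refine MultiplierAlgebra.ext_left fun a => ?_
  refine hf.left_induction (p := fun a => x.left a = y.left a) (by simp) ?_ h a
  intro a a' ha ha'
  rw [map_add, map_add, ha, ha']

/-- The unique extension `f̄ : 𝕄(B) → 𝕄(A)` of a non-degenerate algebra map `f : B → 𝕄(A)` to a
unital algebra map. -/
noncomputable def extend (hf : IsNondegenerateMap f) [Nondegenerate A] : MultiplierAlgebra k B →ₐ[k] MultiplierAlgebra k A :=
  AlgHom.ofLinearMap
    { toFun := hf.extendFun
      map_add' := fun x y => hf.ext_left fun b a => by
        simp [extendFun, extendLeft_apply]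
      map_smul' := fun c x => hf.ext_left fun b a => by
        simp [extendFun, extendLeft_apply] }
    (hf.ext_left fun b a => by simp [extendFun, extendLeft_apply])
    (fun x y => hf.ext_left fun b a => by simp [extendFun, extendLeft_apply])

@[simp] theorem left_extend (hf : IsNondegenerateMap f) [Nondegenerate A] (x : MultiplierAlgebra k B) (b : B) (a : A) :
    (hf.extend x).left ((f b).left a) = (f (x.left b)).left a := hf.extendLeft_apply x b a

@[simp] theorem right_extend (hf : IsNondegenerateMap f) [Nondegenerate A] (x : MultiplierAlgebra k B) (b : B) (a : A) :
    (hf.extend x).right ((f b).right a) = (f (x.right b)).right a := hf.extendRight_apply x b a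

theorem extend_ι (hf : IsNondegenerateMap f) [Nondegenerate A] (b : B) : hf.extend (ι k B b) = f b :=
  hf.ext_left fun b' a => by simp

/-- The algebra map `ḡ ∘ f` attached to a composition is again non-degenerate. -/
theorem comp (hf : IsNondegenerateMap f) [Nondegenerate C] {g : A →ₙₐ[k] MultiplierAlgebra k C}
    (hg : IsNondegenerateMap g) :
    IsNondegenerateMap ((hg.extend : MultiplierAlgebra k A →ₙₐ[k] MultiplierAlgebra k C).comp f) where
  left_surjective := by
    rw [← LinearMap.range_eq_top, eq_top_iff]
    rintro c -
    refine hg.left_induction (p := fun c => c ∈ LinearMap.range _) (zero_mem _)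
      (fun _ _ => add_mem) (fun a c => ?_) c
    refine hf.left_induction (p := fun a => (g a).left c ∈ LinearMap.range _) (by simp) ?_ ?_ a
    · intro a a' h h'
      rw [map_add]; exact add_mem h h'
    · intro b a
      exact ⟨b ⊗ₜ (g a).left c, hg.left_extend _ _ _⟩
  right_surjective := by
    rw [← LinearMap.range_eq_top, eq_top_iff]
    rintro c -
    refine hg.right_induction (p := fun c => c ∈ LinearMap.range _) (zero_mem _)
      (fun _ _ => add_mem) (fun a c => ?_) c
    refine hf.right_induction (p := fun a => (g a).right c ∈ LinearMap.range _) (by simp) ?_ ?_ a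
    · intro a a' h h'
      rw [map_add]; exact add_mem h h'
    · intro b a
      exact ⟨(g a).right c ⊗ₜ b, hg.right_extend _ _ _⟩

end IsNondegenerateMap

/-- The algebra map `B ⊗ D → 𝕄(A ⊗ C)`, `Ψ ∘ (f ⊗ g)`. -/
noncomputable def tensorMap (f : B →ₙₐ[k] MultiplierAlgebra k A)
    (g : D →ₙₐ[k] MultiplierAlgebra k C) : B ⊗[k] D →ₙₐ[k] MultiplierAlgebra k (A ⊗[k] C) where
  toFun x := Ψ k A C (TensorProduct.map (f : B →ₗ[k] MultiplierAlgebra k A)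
    (g : D →ₗ[k] MultiplierAlgebra k C) x)
  map_smul' c x := by simp
  map_zero' := by simp
  map_add' x y := by simp
  map_mul' x y := by
    rw [← map_mul]
    congr 1
    induction x with
    | zero => simp
    | add x x' h h' => simp [add_mul, h, h']
    | tmul b d =>
      induction y with
      | zero => simp
      | add x x' h h' => simp [mul_add, h, h']
      | tmul b d => simp

@[simp] theorem tensorMap_tmul (f : B →ₙₐ[k] MultiplierAlgebra k A)
    (g : D →ₙₐ[k] MultiplierAlgebra k C) (b : B) (d : D) :
    tensorMap f g (b ⊗ₜ d) = Ψ k A C (f b ⊗ₜ g d) := rfl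

theorem IsNondegenerateMap.tensor {f : B →ₙₐ[k] MultiplierAlgebra k A}
    {g : D →ₙₐ[k] MultiplierAlgebra k C} (hf : IsNondegenerateMap f)
    (hg : IsNondegenerateMap g) : IsNondegenerateMap (tensorMap f g) where
  left_surjective := by
    have h : leftAct (tensorMap f g) = TensorProduct.map (leftAct f) (leftAct g) ∘ₗ
        (TensorProduct.tensorTensorTensorComm k B D A C).toLinearMap := by
      ext b d a c; simp
    rw [h, LinearMap.coe_comp]
    exact (TensorProduct.map_surjective hf.left_surjective hg.left_surjective).comp
      (LinearEquiv.surjective _)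
  right_surjective := by
    have h : rightAct (tensorMap f g) = TensorProduct.map (rightAct f) (rightAct g) ∘ₗ
        (TensorProduct.tensorTensorTensorComm k A C B D).toLinearMap := by
      ext b d a c; simp
    rw [h, LinearMap.coe_comp]
    exact (TensorProduct.map_surjective hf.right_surjective hg.right_surjective).comp
      (LinearEquiv.surjective _)

/-- The non-degenerate map `ι ∘ e` attached to a surjective algebra map `e`. -/
theorem IsNondegenerateMap.ofSurjective [Idempotent k A] (e : B →ₙₐ[k] A)
    (he : Function.Surjective e) : IsNondegenerateMap ((ι k A).comp e) where
  left_surjective := by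
    have h : leftAct ((ι k A).comp e) = LinearMap.mul' k A ∘ₗ
        TensorProduct.map (e : B →ₗ[k] A) LinearMap.id := by
      ext b a; simp
    rw [h, LinearMap.coe_comp]
    exact Idempotent.mul_surjective.comp (TensorProduct.map_surjective he Function.surjective_id)
  right_surjective := by
    have h : rightAct ((ι k A).comp e) = LinearMap.mul' k A ∘ₗ
        TensorProduct.map LinearMap.id (e : B →ₗ[k] A) := by
      ext b a; simp
    rw [h, LinearMap.coe_comp]
    exact Idempotent.mul_surjective.comp (TensorProduct.map_surjective Function.surjective_id he)

end NondegenerateMaps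

/-! ### The monoidal category of non-degenerate idempotent projective algebras -/

/-- The objects of `NdI_k`: non-degenerate idempotent `k`-projective algebras. -/
structure NdI (k : Type u) [CommRing k] where
  carrier : Type u
  [ring : NonUnitalRing carrier]
  [module : Module k carrier]
  [isScalarTower : IsScalarTower k carrier carrier]
  [smulCommClass : SMulCommClass k carrier carrier]
  [nondegenerate : Nondegenerate carrier]
  [idempotent : Idempotent k carrier]
  [projective : Module.Projective k carrier]

namespace NdI

attribute [instance] ring module isScalarTower smulCommClass nondegenerate idempotent projective

variable {k : Type u} [CommRing k]

/-- A morphism `B → A` in `NdI_k` is a non-degenerate algebra map `B → 𝕄(A)`, that is, an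
idempotent (hence non-degenerate) extension structure on `A` over `B`. -/
@[ext] structure Hom (B A : NdI k) where
  toMap : B.carrier →ₙₐ[k] MultiplierAlgebra k A.carrier
  isNondegenerate : IsNondegenerateMap toMap

namespace Hom

/-- Morphisms with the same left action agree. -/
theorem ext_left {B A : NdI k} {f g : Hom B A}
    (h : ∀ b a, (f.toMap b).left a = (g.toMap b).left a) : f = g :=
  Hom.ext (NonUnitalAlgHom.ext fun b => MultiplierAlgebra.ext_left (h b))

/-- The morphism `ι ∘ e` attached to a surjective algebra map `e : B → A`. -/
def ofSurjective {B A : NdI k} (e : B.carrier →ₙₐ[k] A.carrier) (he : Function.Surjective e) :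
    Hom B A := ⟨(MultiplierAlgebra.ι k A.carrier).comp e, .ofSurjective e he⟩

/-- The identity of `A`, given by `ι : A → 𝕄(A)`. -/
def id (A : NdI k) : Hom A A :=
  ⟨MultiplierAlgebra.ι k A.carrier,
    .ofSurjective (NonUnitalAlgHom.id k A.carrier) Function.surjective_id⟩

/-- The composition of `f : B → A` and `g : A → R` is given by the algebra map
`ḡ ∘ f : B → 𝕄(R)`. -/
noncomputable def comp {B A R : NdI k} (f : Hom B A) (g : Hom A R) : Hom B R :=
  ⟨(g.isNondegenerate.extend : _ →ₙₐ[k] _).comp f.toMap, f.isNondegenerate.comp g.isNondegenerate⟩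

@[simp] theorem left_ofSurjective {B A : NdI k} (e : B.carrier →ₙₐ[k] A.carrier)
    (he : Function.Surjective e) (b : B.carrier) (a : A.carrier) :
    ((ofSurjective e he).toMap b).left a = e b * a := rfl

@[simp] theorem left_id {A : NdI k} (b a : A.carrier) : ((id A).toMap b).left a = b * a := rfl

@[simp] theorem left_comp {B A R : NdI k} (f : Hom B A) (g : Hom A R) (b : B.carrier)
    (a : A.carrier) (r : R.carrier) : ((f.comp g).toMap b).left ((g.toMap a).left r) =
      (g.toMap ((f.toMap b).left a)).left r :=
  g.isNondegenerate.left_extend _ _ _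

theorem comp_eq_of_left {B A R : NdI k} {f : Hom B A} {g : Hom A R} {h : Hom B R}
    (H : ∀ b a r, (g.toMap ((f.toMap b).left a)).left r =
      (h.toMap b).left ((g.toMap a).left r)) : f.comp g = h :=
  Hom.ext (NonUnitalAlgHom.ext fun b => g.isNondegenerate.ext_left fun a r => by
    rw [left_comp, H])

theorem id_comp {B A : NdI k} (f : Hom B A) : (id B).comp f = f :=
  comp_eq_of_left fun b a r => by simp

theorem comp_id {B A : NdI k} (f : Hom B A) : f.comp (id A) = f :=
  comp_eq_of_left fun b a r => by simp [MultiplierAlgebra.left_apply_mul]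

theorem assoc {B A R S : NdI k} (f : Hom B A) (g : Hom A R) (h : Hom R S) :
    (f.comp g).comp h = f.comp (g.comp h) := by
  refine comp_eq_of_left fun b r s => ?_
  refine g.isNondegenerate.left_induction (p := fun r => (h.toMap (((f.comp g).toMap b).left r)).left
    s = ((f.comp (g.comp h)).toMap b).left ((h.toMap r).left s)) (by simp) ?_ (fun a r => ?_) r
  · intro r r' h h'
    simp only [map_add, MultiplierAlgebra.left_add, h, h']
  · rw [left_comp, ← left_comp g h a, left_comp f (g.comp h), left_comp g h]

end Hom

noncomputable instance : Category (NdI k) where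
  Hom := Hom
  id := Hom.id
  comp := Hom.comp
  id_comp := Hom.id_comp
  comp_id := Hom.comp_id
  assoc := Hom.assoc

/-- The tensor product of algebras, with product `(a ⊗ b)(a' ⊗ b') = aa' ⊗ bb'`. -/
def tensor (A B : NdI k) : NdI k := ⟨A.carrier ⊗[k] B.carrier⟩

/-- The unit object `k`. -/
def unit (k : Type u) [CommRing k] : NdI k := ⟨k⟩

namespace Hom

/-- The tensor product of morphisms, given by the algebra map `Ψ ∘ (f ⊗ g)`. -/
noncomputable def tensor {B A D C : NdI k} (f : Hom B A) (g : Hom D C) :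
    Hom (B.tensor D) (A.tensor C) :=
  ⟨tensorMap f.toMap g.toMap, f.isNondegenerate.tensor g.isNondegenerate⟩

theorem tensor_comp_tensor {B A R B' A' R' : NdI k} (f : Hom B A) (g : Hom A R) (f' : Hom B' A')
    (g' : Hom A' R') :
    (f.tensor f').comp (g.tensor g') = (f.comp g).tensor (f'.comp g') := by
  refine comp_eq_of_left fun b a r => ?_
  change B.carrier ⊗[k] B'.carrier at b
  change A.carrier ⊗[k] A'.carrier at a
  change R.carrier ⊗[k] R'.carrier at r
  change (tensorMap g.toMap g'.toMap ((tensorMap f.toMap f'.toMap b).left a)).left r =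
    (tensorMap (f.comp g).toMap (f'.comp g').toMap b).left ((tensorMap g.toMap g'.toMap a).left r)
  induction b with
  | zero => simp
  | add b b' h h' => simp only [map_add, MultiplierAlgebra.left_add, h, h']
  | tmul b b' =>
    induction a with
    | zero => simp
    | add a a' h h' => simp only [map_add, MultiplierAlgebra.left_add, h, h']
    | tmul a a' =>
      induction r with
      | zero => simp
      | add r r' h h' => simp only [map_add, h, h']
      | tmul r r' => simp

theorem comp_ofSurjective {B A R : NdI k} {f : Hom B A} {e : A.carrier →ₙₐ[k] R.carrier}
    {he : Function.Surjective e} {h : Hom B R}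
    (H : ∀ b a, e ((f.toMap b).left a) = (h.toMap b).left (e a)) :
    f.comp (ofSurjective e he) = h :=
  comp_eq_of_left fun b a r => by
    rw [left_ofSurjective, left_ofSurjective, MultiplierAlgebra.left_apply_mul, H]

theorem ofSurjective_comp {B A R : NdI k} {g : Hom A R} {e : B.carrier →ₙₐ[k] A.carrier}
    {he : Function.Surjective e} {h : Hom B R}
    (H : ∀ b r, (g.toMap (e b)).left r = (h.toMap b).left r) :
    (ofSurjective e he).comp g = h :=
  comp_eq_of_left fun b a r => by
    rw [left_ofSurjective, map_mul, MultiplierAlgebra.left_mul, H]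

theorem ofSurjective_comp_ofSurjective {B A R : NdI k} (e : B.carrier →ₙₐ[k] A.carrier)
    (he : Function.Surjective e) (e' : A.carrier →ₙₐ[k] R.carrier)
    (he' : Function.Surjective e') :
    (ofSurjective e he).comp (ofSurjective e' he') = ofSurjective (e'.comp e) (he'.comp he) :=
  ofSurjective_comp fun _ _ => rfl

theorem ofSurjective_congr {B A : NdI k} {e e' : B.carrier →ₙₐ[k] A.carrier}
    {he : Function.Surjective e} {he' : Function.Surjective e'} (h : ∀ b, e b = e' b) :
    ofSurjective e he = ofSurjective e' he' := by
  obtain rfl : e = e' := NonUnitalAlgHom.ext h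
  rfl

end Hom

/-- The isomorphism in `NdI_k` attached to a multiplicative linear bijection. -/
def isoOfLinearEquiv {B A : NdI k} (e : B.carrier ≃ₗ[k] A.carrier)
    (he : ∀ x y, e (x * y) = e x * e y) : B ≅ A where
  hom := Hom.ofSurjective
    { e with map_smul' := e.map_smul, map_zero' := e.map_zero, map_mul' := he } e.surjective
  inv := Hom.ofSurjective
    { e.symm with
      map_smul' := e.symm.map_smul
      map_zero' := e.symm.map_zero
      map_mul' := fun x y => e.injective (by simp [he]) } e.symm.surjective
  hom_inv_id := (Hom.ofSurjective_comp_ofSurjective ..).trans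
    (Hom.ofSurjective_congr (e' := NonUnitalAlgHom.id k _) (he' := Function.surjective_id)
      fun b => e.symm_apply_apply b)
  inv_hom_id := (Hom.ofSurjective_comp_ofSurjective ..).trans
    (Hom.ofSurjective_congr (e' := NonUnitalAlgHom.id k _) (he' := Function.surjective_id)
      fun b => e.apply_symm_apply b)

theorem assoc_mul {A B C : Type*} [NonUnitalRing A] [Module k A] [IsScalarTower k A A]
    [SMulCommClass k A A] [NonUnitalRing B] [Module k B] [IsScalarTower k B B]
    [SMulCommClass k B B] [NonUnitalRing C] [Module k C] [IsScalarTower k C C]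
    [SMulCommClass k C C] (x y : (A ⊗[k] B) ⊗[k] C) :
    TensorProduct.assoc k A B C (x * y) =
      TensorProduct.assoc k A B C x * TensorProduct.assoc k A B C y := by
  induction x with
  | zero => simp
  | add x x' h h' => simp only [add_mul, map_add, h, h']
  | tmul x c =>
    induction x with
    | zero => simp
    | add x x' h h' => simp only [add_mul, TensorProduct.add_tmul, map_add, h, h']
    | tmul a b =>
      induction y with
      | zero => simp
      | add y y' h h' => simp only [mul_add, map_add, h, h']
      | tmul y c' =>
        induction y with
        | zero => simp
        | add y y' h h' => simp only [mul_add, TensorProduct.add_tmul, map_add, h, h']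
        | tmul a' b' => simp

theorem lid_mul {A : Type*} [NonUnitalRing A] [Module k A] [IsScalarTower k A A]
    [SMulCommClass k A A] (x y : k ⊗[k] A) :
    TensorProduct.lid k A (x * y) = TensorProduct.lid k A x * TensorProduct.lid k A y := by
  induction x with
  | zero => simp
  | add x x' h h' => simp only [add_mul, map_add, h, h']
  | tmul c a =>
    induction y with
    | zero => simp
    | add y y' h h' => simp only [mul_add, map_add, h, h']
    | tmul c' a' => simp [smul_mul_smul_comm]

theorem rid_mul {A : Type*} [NonUnitalRing A] [Module k A] [IsScalarTower k A A]
    [SMulCommClass k A A] (x y : A ⊗[k] k) :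
    TensorProduct.rid k A (x * y) = TensorProduct.rid k A x * TensorProduct.rid k A y := by
  induction x with
  | zero => simp
  | add x x' h h' => simp only [add_mul, map_add, h, h']
  | tmul c a =>
    induction y with
    | zero => simp
    | add y y' h h' => simp only [mul_add, map_add, h, h']
    | tmul c' a' => simp [smul_mul_smul_comm]

/-- The associativity constraint `(a ⊗ b) ⊗ c ↦ a ⊗ (b ⊗ c)`. -/
def assocIso (A B C : NdI k) : (A.tensor B).tensor C ≅ A.tensor (B.tensor C) :=
  isoOfLinearEquiv (B := (A.tensor B).tensor C) (A := A.tensor (B.tensor C))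
    (TensorProduct.assoc k A.carrier B.carrier C.carrier) assoc_mul

/-- The left unit constraint `c ⊗ a ↦ c • a`. -/
def lidIso (A : NdI k) : (unit k).tensor A ≅ A :=
  isoOfLinearEquiv (B := (unit k).tensor A) (A := A) (TensorProduct.lid k A.carrier) (lid_mul (k := k) (A := A.carrier))

/-- The right unit constraint `a ⊗ c ↦ c • a`. -/
def ridIso (A : NdI k) : A.tensor (unit k) ≅ A :=
  isoOfLinearEquiv (B := A.tensor (unit k)) (A := A) (TensorProduct.rid k A.carrier) (rid_mul (k := k) (A := A.carrier))

noncomputable instance : MonoidalCategoryStruct (NdI k) where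
  tensorObj := tensor
  whiskerLeft X _ _ f := (Hom.id X).tensor f
  whiskerRight f Y := Hom.tensor f (Hom.id Y)
  tensorHom f g := Hom.tensor f g
  tensorUnit := unit k
  associator := assocIso
  leftUnitor := lidIso
  rightUnitor := ridIso

/-- The morphism `f` has the form `ι ∘ φ`. -/
def Hom.IsOf {B A : NdI k} (f : Hom B A) (φ : B.carrier →ₗ[k] A.carrier) : Prop :=
  ∀ b a, (f.toMap b).left a = φ b * a

namespace Hom.IsOf

theorem eq {B A : NdI k} {f g : Hom B A} {φ ψ : B.carrier →ₗ[k] A.carrier} (hf : f.IsOf φ)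
    (hg : g.IsOf ψ) (h : φ = ψ) : f = g :=
  Hom.ext_left fun b a => by rw [hf, hg, h]

theorem id (A : NdI k) : (Hom.id A).IsOf LinearMap.id := fun _ _ => rfl

theorem left_comp {B A R : NdI k} {f : Hom B A} {φ : B.carrier →ₗ[k] A.carrier} (hf : f.IsOf φ)
    (g : Hom A R) (b : B.carrier) (r : R.carrier) :
    ((f.comp g).toMap b).left r = (g.toMap (φ b)).left r := by
  refine g.isNondegenerate.left_induction
    (p := fun r => ((f.comp g).toMap b).left r = (g.toMap (φ b)).left r)
    (by simp) (fun r r' h h' => by rw [map_add, map_add, h, h']) (fun a r => ?_) r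
  rw [Hom.left_comp, hf, map_mul, MultiplierAlgebra.left_mul]

theorem comp {B A R : NdI k} {f : Hom B A} {φ : B.carrier →ₗ[k] A.carrier} (hf : f.IsOf φ)
    {g : Hom A R} {ψ : A.carrier →ₗ[k] R.carrier} (hg : g.IsOf ψ) : (f.comp g).IsOf (ψ ∘ₗ φ) :=
  fun b r => by rw [hf.left_comp, hg, LinearMap.comp_apply]

theorem tensor {B A D C : NdI k} {f : Hom B A} {φ : B.carrier →ₗ[k] A.carrier} (hf : f.IsOf φ)
    {g : Hom D C} {ψ : D.carrier →ₗ[k] C.carrier} (hg : g.IsOf ψ) :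
    (f.tensor g).IsOf (TensorProduct.map φ ψ) := by
  intro b a
  change B.carrier ⊗[k] D.carrier at b
  change A.carrier ⊗[k] C.carrier at a
  change (tensorMap f.toMap g.toMap b).left a = TensorProduct.map φ ψ b * a
  induction b with
  | zero => simp
  | add b b' h h' => simp only [map_add, MultiplierAlgebra.left_add, add_mul, h, h']
  | tmul b b' =>
    induction a with
    | zero => simp
    | add a a' h h' => simp only [map_add, mul_add, h, h']
    | tmul a a' => simp [hf b, hg b']

end Hom.IsOf

theorem isOf_iso {B A : NdI k} (e : B.carrier ≃ₗ[k] A.carrier)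
    (he : ∀ x y, e (x * y) = e x * e y) : Hom.IsOf (isoOfLinearEquiv e he).hom e.toLinearMap :=
  fun _ _ => rfl

theorem naturality {B A B' A' : NdI k} (f : Hom B A) (f' : Hom B' A')
    (e : B.carrier ≃ₗ[k] B'.carrier) (he : ∀ x y, e (x * y) = e x * e y)
    (e' : A.carrier ≃ₗ[k] A'.carrier) (he' : ∀ x y, e' (x * y) = e' x * e' y)
    (h : ∀ b a, e' ((f.toMap b).left a) = (f'.toMap (e b)).left (e' a)) :
    f.comp (isoOfLinearEquiv e' he').hom = Hom.comp (isoOfLinearEquiv e he).hom f' := by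
  refine Hom.comp_ofSurjective (he := e'.surjective) fun b a => ?_
  rw [(isOf_iso e he).left_comp]
  exact h b a

theorem assoc_naturality {X₁ X₂ X₃ Y₁ Y₂ Y₃ : NdI k} (f₁ : Hom X₁ Y₁) (f₂ : Hom X₂ Y₂)
    (f₃ : Hom X₃ Y₃) : ((f₁.tensor f₂).tensor f₃).comp (assocIso Y₁ Y₂ Y₃).hom =
      Hom.comp (assocIso X₁ X₂ X₃).hom (f₁.tensor (f₂.tensor f₃)) := by
  refine naturality _ _ _ _ _ _ fun b a => ?_
  change (X₁.carrier ⊗[k] X₂.carrier) ⊗[k] X₃.carrier at b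
  change (Y₁.carrier ⊗[k] Y₂.carrier) ⊗[k] Y₃.carrier at a
  change TensorProduct.assoc k Y₁.carrier Y₂.carrier Y₃.carrier
      ((tensorMap (tensorMap f₁.toMap f₂.toMap) f₃.toMap b).left a) =
    (tensorMap f₁.toMap (tensorMap f₂.toMap f₃.toMap) (TensorProduct.assoc k _ _ _ b)).left
      (TensorProduct.assoc k _ _ _ a)
  induction b with
  | zero => simp
  | add b b' h h' => simp only [map_add, MultiplierAlgebra.left_add, h, h']
  | tmul b b₃ =>
    induction b with
    | zero => simp
    | add b b' h h' =>
      simp only [TensorProduct.add_tmul, map_add, MultiplierAlgebra.left_add, h, h']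
    | tmul b₁ b₂ =>
      induction a with
      | zero => simp
      | add a a' h h' => simp only [map_add, h, h']
      | tmul a a₃ =>
        induction a with
        | zero => simp
        | add a a' h h' => simp only [TensorProduct.add_tmul, map_add, h, h']
        | tmul a₁ a₂ => simp

theorem lid_naturality {X Y : NdI k} (f : Hom X Y) :
    ((Hom.id (unit k)).tensor f).comp (lidIso Y).hom = Hom.comp (lidIso X).hom f := by
  refine naturality _ _ _ _ _ _ fun b a => ?_
  change k ⊗[k] X.carrier at b
  change k ⊗[k] Y.carrier at a
  change TensorProduct.lid k Y.carrier ((tensorMap (MultiplierAlgebra.ι k k) f.toMap b).left a) =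
    (f.toMap (TensorProduct.lid k X.carrier b)).left (TensorProduct.lid k Y.carrier a)
  induction b with
  | zero => simp
  | add b b' h h' => simp only [map_add, MultiplierAlgebra.left_add, h, h']
  | tmul c b =>
    induction a with
    | zero => simp
    | add a a' h h' => simp only [map_add, h, h']
    | tmul c' a => simpa [mul_smul] using smul_comm c c' _

theorem rid_naturality {X Y : NdI k} (f : Hom X Y) :
    (f.tensor (Hom.id (unit k))).comp (ridIso Y).hom = Hom.comp (ridIso X).hom f := by
  refine naturality _ _ _ _ _ _ fun b a => ?_
  change X.carrier ⊗[k] k at b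
  change Y.carrier ⊗[k] k at a
  change TensorProduct.rid k Y.carrier ((tensorMap f.toMap (MultiplierAlgebra.ι k k) b).left a) =
    (f.toMap (TensorProduct.rid k X.carrier b)).left (TensorProduct.rid k Y.carrier a)
  induction b with
  | zero => simp
  | add b b' h h' => simp only [map_add, MultiplierAlgebra.left_add, h, h']
  | tmul b c =>
    induction a with
    | zero => simp
    | add a a' h h' => simp only [map_add, h, h']
    | tmul a c' => simpa [mul_smul] using smul_comm c c' _

theorem pentagon (W X Y Z : NdI k) :
    Hom.comp (Hom.tensor (assocIso W X Y).hom (Hom.id Z))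
      (Hom.comp (assocIso W (X.tensor Y) Z).hom (Hom.tensor (Hom.id W) (assocIso X Y Z).hom)) =
    Hom.comp (assocIso (W.tensor X) Y Z).hom (assocIso W X (Y.tensor Z)).hom := by
  refine Hom.IsOf.eq (((isOf_iso _ _).tensor (.id Z)).comp
    ((isOf_iso _ _).comp ((Hom.IsOf.id W).tensor (isOf_iso _ _))))
    ((isOf_iso _ _).comp (isOf_iso _ _)) ?_
  exact TensorProduct.ext_fourfold fun _ _ _ _ => rfl

theorem triangle (X Y : NdI k) :
    Hom.comp (assocIso X (unit k) Y).hom (Hom.tensor (Hom.id X) (lidIso Y).hom) =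
      Hom.tensor (ridIso X).hom (Hom.id Y) := by
  refine Hom.IsOf.eq ((isOf_iso _ _).comp ((Hom.IsOf.id X).tensor (isOf_iso _ _)))
    ((isOf_iso _ _).tensor (.id Y)) ?_
  exact TensorProduct.ext_threefold fun x (c : k) y =>
    (TensorProduct.smul_tmul (R := k) (R' := k) c x y).symm

noncomputable instance : MonoidalCategory (NdI k) :=
  MonoidalCategory.ofTensorHom
    (id_tensorHom_id := fun X Y => ((Hom.IsOf.id X).tensor (.id Y)).eq (Hom.IsOf.id _)
      TensorProduct.map_id)
    (id_tensorHom := fun _ _ _ _ => rfl)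
    (tensorHom_id := fun _ _ => rfl)
    (tensorHom_comp_tensorHom := fun f₁ f₂ g₁ g₂ => Hom.tensor_comp_tensor f₁ g₁ f₂ g₂)
    (associator_naturality := assoc_naturality)
    (leftUnitor_naturality := lid_naturality)
    (rightUnitor_naturality := rid_naturality)
    (pentagon := pentagon)
    (triangle := triangle)

end NdI

/-! ### Multiplier Hopf algebras -/

section MultiplierHopf

open MultiplierAlgebra

variable {k : Type*} [CommRing k]
variable {A : Type*} [NonUnitalRing A] [Module k A] [IsScalarTower k A A] [SMulCommClass k A A]
variable (Δ : A →ₙₐ[k] MultiplierAlgebra k (A ⊗[k] A))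

/-- The linear map `A ⊗ A → 𝕄(A ⊗ A)`, `a ⊗ b ↦ Δ(a)(1 ⊗ b)`. -/
noncomputable def galoisMap₁ : A ⊗[k] A →ₗ[k] MultiplierAlgebra k (A ⊗[k] A) :=
  TensorProduct.lift (LinearMap.mk₂ k (fun a b => Δ a * Ψ k A A (1 ⊗ₜ ι k A b))
    (fun a a' b => by rw [map_add, add_mul])
    (fun c a b => by rw [map_smul, smul_mul_assoc])
    (fun a b b' => by rw [map_add, TensorProduct.tmul_add, map_add, mul_add])
    (fun c a b => by rw [map_smul, TensorProduct.tmul_smul, map_smul, mul_smul_comm]))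

/-- The linear map `A ⊗ A → 𝕄(A ⊗ A)`, `a ⊗ b ↦ (a ⊗ 1)Δ(b)`. -/
noncomputable def galoisMap₂ : A ⊗[k] A →ₗ[k] MultiplierAlgebra k (A ⊗[k] A) :=
  TensorProduct.lift (LinearMap.mk₂ k (fun a b => Ψ k A A (ι k A a ⊗ₜ 1) * Δ b)
    (fun a a' b => by rw [map_add, TensorProduct.add_tmul, map_add, add_mul])
    (fun c a b => by rw [map_smul, ← TensorProduct.smul_tmul', map_smul, smul_mul_assoc])
    (fun a b b' => by rw [map_add, mul_add])
    (fun c a b => by rw [map_smul, mul_smul_comm]))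

theorem galoisMap₁_tmul (a b : A) :
    galoisMap₁ Δ (a ⊗ₜ b) = Δ a * Ψ k A A (1 ⊗ₜ ι k A b) := rfl

theorem galoisMap₂_tmul (a b : A) :
    galoisMap₂ Δ (a ⊗ₜ b) = Ψ k A A (ι k A a ⊗ₜ 1) * Δ b := rfl

/-- The embedding `ι : A ⊗ A → 𝕄(A ⊗ A)` as a linear map. -/
noncomputable abbrev ιTensor (k A : Type*) [CommRing k] [NonUnitalRing A] [Module k A]
    [IsScalarTower k A A] [SMulCommClass k A A] :
    A ⊗[k] A →ₗ[k] MultiplierAlgebra k (A ⊗[k] A) := ι k (A ⊗[k] A)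

/-- The conditions `Δ(a)(1 ⊗ b) ∈ A ⊗ A` and `(a ⊗ 1)Δ(b) ∈ A ⊗ A`, where `A ⊗ A` is regarded as a
subset of `𝕄(A ⊗ A)` by means of `ι`. -/
structure IsCovered : Prop where
  right_mem : ∀ a b, ∃ t : A ⊗[k] A, ι k (A ⊗[k] A) t = Δ a * Ψ k A A (1 ⊗ₜ ι k A b)
  left_mem : ∀ a b, ∃ t : A ⊗[k] A, ι k (A ⊗[k] A) t = Ψ k A A (ι k A a ⊗ₜ 1) * Δ b

variable {Δ}

theorem IsCovered.galoisMap₁_mem (h : IsCovered Δ) (t : A ⊗[k] A) :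
    galoisMap₁ Δ t ∈ LinearMap.range (ιTensor k A) := by
  induction t with
  | zero => simp
  | add x y hx hy => rw [map_add]; exact add_mem hx hy
  | tmul a b => exact h.right_mem a b

theorem IsCovered.galoisMap₂_mem (h : IsCovered Δ) (t : A ⊗[k] A) :
    galoisMap₂ Δ t ∈ LinearMap.range (ιTensor k A) := by
  induction t with
  | zero => simp
  | add x y hx hy => rw [map_add]; exact add_mem hx hy
  | tmul a b => exact h.left_mem a b

variable [Nondegenerate A] [Module.Projective k A]

/-- The map `T₁ : A ⊗ A → A ⊗ A`, `T₁(a ⊗ b) = Δ(a)(1 ⊗ b)`. -/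
noncomputable def IsCovered.T₁ (h : IsCovered Δ) : A ⊗[k] A →ₗ[k] A ⊗[k] A :=
  (LinearEquiv.ofInjective (ιTensor k A) ι_injective).symm.toLinearMap ∘ₗ
    (galoisMap₁ Δ).codRestrict _ h.galoisMap₁_mem

/-- The map `T₂ : A ⊗ A → A ⊗ A`, `T₂(a ⊗ b) = (a ⊗ 1)Δ(b)`. -/
noncomputable def IsCovered.T₂ (h : IsCovered Δ) : A ⊗[k] A →ₗ[k] A ⊗[k] A :=
  (LinearEquiv.ofInjective (ιTensor k A) ι_injective).symm.toLinearMap ∘ₗ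
    (galoisMap₂ Δ).codRestrict _ h.galoisMap₂_mem

theorem IsCovered.ι_T₁ (h : IsCovered Δ) (a b : A) :
    ι k (A ⊗[k] A) (h.T₁ (a ⊗ₜ b)) = Δ a * Ψ k A A (1 ⊗ₜ ι k A b) :=
  congrArg Subtype.val ((LinearEquiv.ofInjective (ιTensor k A) ι_injective).apply_symm_apply
    ((galoisMap₁ Δ).codRestrict _ h.galoisMap₁_mem (a ⊗ₜ b)))

theorem IsCovered.ι_T₂ (h : IsCovered Δ) (a b : A) :
    ι k (A ⊗[k] A) (h.T₂ (a ⊗ₜ b)) = Ψ k A A (ι k A a ⊗ₜ 1) * Δ b :=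
  congrArg Subtype.val ((LinearEquiv.ofInjective (ιTensor k A) ι_injective).apply_symm_apply
    ((galoisMap₂ Δ).codRestrict _ h.galoisMap₂_mem (a ⊗ₜ b)))

/-- A map `Δ : A → 𝕄(A ⊗ A)` satisfying the covering conditions is coassociative if
`(a ⊗ 1 ⊗ 1) (Δ ⊗ A)(Δ(b)(1 ⊗ c)) = (A ⊗ Δ)((a ⊗ 1)Δ(b)) (1 ⊗ 1 ⊗ c)` in `𝕄(A ⊗ A ⊗ A)`,
for all `a`, `b`, `c`.  -/
def IsCovered.IsCoassociative (h : IsCovered Δ) : Prop :=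
  ∀ a b c : A,
    transport (TensorProduct.assoc k A A A) NdI.assoc_mul
      (Ψ k (A ⊗[k] A) A (Ψ k A A (ι k A a ⊗ₜ 1) ⊗ₜ 1) * tensorMap Δ (ι k A) (h.T₁ (b ⊗ₜ c))) =
    tensorMap (ι k A) Δ (h.T₂ (a ⊗ₜ b)) * Ψ k A (A ⊗[k] A) (1 ⊗ₜ Ψ k A A (1 ⊗ₜ ι k A c))

variable (Δ) in
/-- Van Daele's multiplier Hopf algebras: a non-degenerate `k`-projective algebra `A` together with
a coassociative algebra map `Δ : A → 𝕄(A ⊗ A)` that satisfies the covering conditions, and for which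
`T₁` and `T₂` are bijective. -/
structure IsMultiplierHopfAlgebra : Prop where
  covered : IsCovered Δ
  coassociative : covered.IsCoassociative
  bijective_T₁ : Function.Bijective covered.T₁
  bijective_T₂ : Function.Bijective covered.T₂

end MultiplierHopf

end MultHopf

/-! In a Hopf algebra `T₁⁻¹(a ⊗ b) = a₁ ⊗ S(a₂)b`, so multiplying the two legs of `T₁⁻¹` yields
`ε(a)b`; symmetrically `μ T₂⁻¹(a ⊗ b) = ε(b)a`. This recovers a counit from the bijectivity of `T₁`
and `T₂` alone, with no antipode.

Coassociativity says that `T₂ ⊗ A` and `A ⊗ T₁` commute on `A ⊗ A ⊗ A` (`IsCoassociative.comm`).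
With the identity `(a ⊗ 1)T₁(b ⊗ c) = T₂(a ⊗ b)(1 ⊗ c)` it gives `(A ⊗ μT₁⁻¹)(T₂(a ⊗ b) ⊗ c) = ab ⊗
c` (`lTensor_mulInv₁`), and, as `T₂` is surjective, `a ⊗ μT₁⁻¹(b ⊗ c) = μT₂⁻¹(a ⊗ b) ⊗ c`
(`tmul_mulInv₁`). Over a field and for `A ≠ 0` such an equality forces both maps to be scalar, with
the same linear form `ε` (`exists_counit`).

The rest follows from `ε`. The identity `(ε ⊗ A)T₁(a ⊗ b) = ab` shows that `ε ≠ 0`, because the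
product of `A` is not zero; then `b = μT₁⁻¹(a ⊗ b)` for any `a` with `ε(a) = 1`, so `A` is
idempotent. The same identity gives multiplicativity of `ε` and the counit laws. Idempotency and
surjectivity of `T₁`, `T₂` make `Δ` a morphism. Finally, comonoid coassociativity is an equality of
multipliers of `A ⊗ A ⊗ A`; these are determined by their products with `a ⊗ 1 ⊗ 1` on the left and
`1 ⊗ 1 ⊗ c` on the right (`ext_outer_mul`), and there the equality is the coassociativity axiom. -/

namespace MultHopf

open MultiplierAlgebra

/-! ### Multipliers of `A` and the image of `ι`. -/

namespace MultiplierAlgebra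

variable {k : Type*} [CommRing k]
variable {A : Type*} [NonUnitalRing A] [Module k A] [IsScalarTower k A A] [SMulCommClass k A A]
variable {B : Type*} [NonUnitalRing B] [Module k B] [IsScalarTower k B B] [SMulCommClass k B B]

/-- With `ι_right`, this makes `ι(A)` a two-sided ideal of `𝕄(A)`. When `ι` is injective, identities
between elements of `A` can then be verified by associativity in `𝕄(A)`. -/
theorem ι_left (x : MultiplierAlgebra k A) (t : A) : ι k A (x.left t) = x * ι k A t :=
  ext (fun b => (left_apply_mul x t b).symm) (fun b => mul_left_apply x b t)

theorem ι_right (x : MultiplierAlgebra k A) (t : A) : ι k A (x.right t) = ι k A t * x :=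
  ext (fun b => (mul_left_apply x t b).symm) (fun b => (right_apply_mul x b t).symm)

theorem Ψ_ι_tmul_ι (a : A) (b : B) : Ψ k A B (ι k A a ⊗ₜ ι k B b) = ι k (A ⊗[k] B) (a ⊗ₜ b) := by
  refine ext (fun t => ?_) (fun t => ?_)
  · induction t with
    | zero => simp
    | add x y hx hy => simp only [map_add, hx, hy]
    | tmul x y => simp
  · induction t with
    | zero => simp
    | add x y hx hy => simp only [map_add, hx, hy]
    | tmul x y => simp

theorem transport_ι (e : A ≃ₗ[k] B) (he : ∀ a a', e (a * a') = e a * e a') (a : A) :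
    transport e he (ι k A a) = ι k B (e a) :=
  ext (fun b => by simp [transport, he]) (fun b => by simp [transport, he])

theorem transport_mul (e : A ≃ₗ[k] B) (he : ∀ a a', e (a * a') = e a * e a')
    (x y : MultiplierAlgebra k A) :
    transport e he (x * y) = transport e he x * transport e he y :=
  ext (fun b => by simp [transport]) (fun b => by simp [transport])

end MultiplierAlgebra

/-! ### Relations between `T₁` and `T₂`, and coassociativity in terms of them. -/

namespace IsCovered

section Galois

variable {k : Type*} [CommRing k]
variable {A : Type*} [NonUnitalRing A] [Module k A] [IsScalarTower k A A] [SMulCommClass k A A]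
variable [Nondegenerate A] [Module.Projective k A]
variable {Δ : A →ₙₐ[k] MultiplierAlgebra k (A ⊗[k] A)}

theorem T₁_mul (h : IsCovered Δ) (a b x y : A) :
    h.T₁ (a ⊗ₜ b) * x ⊗ₜ y = (Δ a).left (x ⊗ₜ (b * y)) :=
  congrArg (fun z => left z (x ⊗ₜ y)) (h.ι_T₁ a b)

theorem T₂_mul (h : IsCovered Δ) (a b : A) (t : A ⊗[k] A) :
    h.T₂ (a ⊗ₜ b) * t = (LinearMap.mulLeft k a).rTensor A ((Δ b).left t) :=
  congrArg (fun z => left z t) (h.ι_T₂ a b)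

theorem mul_T₂ (h : IsCovered Δ) (a b x y : A) :
    x ⊗ₜ y * h.T₂ (a ⊗ₜ b) = (Δ b).right ((x * a) ⊗ₜ y) :=
  congrArg (fun z => right z (x ⊗ₜ y)) (h.ι_T₂ a b)

/-- The identity `(a ⊗ 1)(Δ(b)(1 ⊗ c)) = ((a ⊗ 1)Δ(b))(1 ⊗ c)`. -/
theorem rTensor_mulLeft_T₁ (h : IsCovered Δ) (a b c : A) :
    (LinearMap.mulLeft k a).rTensor A (h.T₁ (b ⊗ₜ c)) =
      (LinearMap.mulRight k c).lTensor A (h.T₂ (a ⊗ₜ b)) := by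
  apply ι_injective (k := k)
  -- Both maps on `A ⊗ A` are actions of multipliers, `a ⊗ 1` on the left and `1 ⊗ c` on the right,
  -- so the claim becomes associativity in `𝕄(A ⊗ A)`.
  change ι k _ ((Ψ k A A (ι k A a ⊗ₜ 1)).left (h.T₁ (b ⊗ₜ c))) =
    ι k _ ((Ψ k A A (1 ⊗ₜ ι k A c)).right (h.T₂ (a ⊗ₜ b)))
  rw [ι_left, ι_right, ι_T₁, ι_T₂, mul_assoc]

/-- For `t = p ⊗ q` the product is `(a ⊗ 1)Δ(p) ⊗ q = T₂(a ⊗ p) ⊗ q`. Hence one side of the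
coassociativity axiom already lies in `A ⊗ A ⊗ A`; `ι_lTensor_T₁` does the same for the other side.
-/
theorem ι_rTensor_T₂ (h : IsCovered Δ) (a : A) (t : A ⊗[k] A) :
    Ψ k (A ⊗[k] A) A (Ψ k A A (ι k A a ⊗ₜ 1) ⊗ₜ 1) * tensorMap Δ (ι k A) t =
      ι k _ (h.T₂.rTensor A ((TensorProduct.assoc k A A A).symm (a ⊗ₜ t))) := by
  induction t with
  | zero => simp
  | add x y hx hy => simp only [map_add, mul_add, hx, hy, TensorProduct.tmul_add]
  | tmul p q =>
    rw [tensorMap_tmul, ← map_mul, Algebra.TensorProduct.tmul_mul_tmul, ← h.ι_T₂, one_mul,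
      Ψ_ι_tmul_ι]
    rfl

theorem ι_lTensor_T₁ (h : IsCovered Δ) (c : A) (t : A ⊗[k] A) :
    tensorMap (ι k A) Δ t * Ψ k A (A ⊗[k] A) (1 ⊗ₜ Ψ k A A (1 ⊗ₜ ι k A c)) =
      ι k _ (h.T₁.lTensor A (TensorProduct.assoc k A A A (t ⊗ₜ c))) := by
  induction t with
  | zero => simp
  | add x y hx hy => simp only [map_add, add_mul, hx, hy, TensorProduct.add_tmul]
  | tmul p q =>
    rw [tensorMap_tmul, ← map_mul, Algebra.TensorProduct.tmul_mul_tmul, ← h.ι_T₁, mul_one,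
      Ψ_ι_tmul_ι]
    rfl

/-- Coassociativity says that `T₂ ⊗ A` and `A ⊗ T₁` commute. -/
theorem IsCoassociative.comm {h : IsCovered Δ} (hc : h.IsCoassociative) (a b c : A) :
    TensorProduct.assoc k A A A
        (h.T₂.rTensor A ((TensorProduct.assoc k A A A).symm (a ⊗ₜ h.T₁ (b ⊗ₜ c)))) =
      h.T₁.lTensor A (TensorProduct.assoc k A A A (h.T₂ (a ⊗ₜ b) ⊗ₜ c)) := by
  apply ι_injective (k := k)
  rw [← ι_lTensor_T₁, ← hc, ι_rTensor_T₂, transport_ι]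

/-- On `u = p ⊗ q`, multiplying the last two legs of `T₂(a ⊗ p) ⊗ q` gives `T₂(a ⊗ p)(1 ⊗ q)`, which
is `(a ⊗ 1)T₁(p ⊗ q)` by `rTensor_mulLeft_T₁`. -/
theorem lTensor_mul_rTensor_T₂ (h : IsCovered Δ) (a : A) (u : A ⊗[k] A) :
    (LinearMap.mul' k A).lTensor A (TensorProduct.assoc k A A A
        (h.T₂.rTensor A ((TensorProduct.assoc k A A A).symm (a ⊗ₜ u)))) =
      (LinearMap.mulLeft k a).rTensor A (h.T₁ u) := by
  induction u with
  | zero => simp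
  | add x y hx hy => simp only [map_add, TensorProduct.tmul_add, hx, hy]
  | tmul p q =>
    rw [rTensor_mulLeft_T₁, TensorProduct.assoc_symm_tmul, LinearMap.rTensor_tmul]
    -- Both sides are linear in the value of `T₂`, so it may be replaced by a pure tensor.
    induction h.T₂ (a ⊗ₜ p) with
    | zero => simp
    | add x y hx hy => simp only [map_add, TensorProduct.add_tmul, hx, hy]
    | tmul r s => simp

theorem rTensor_mul_lTensor_T₁ (h : IsCovered Δ) (c : A) (w : A ⊗[k] A) :
    (LinearMap.mul' k A).rTensor A ((TensorProduct.assoc k A A A).symm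
        (h.T₁.lTensor A (TensorProduct.assoc k A A A (w ⊗ₜ c)))) =
      (LinearMap.mulRight k c).lTensor A (h.T₂ w) := by
  induction w with
  | zero => simp
  | add x y hx hy => simp only [map_add, TensorProduct.add_tmul, hx, hy]
  | tmul p q =>
    rw [← rTensor_mulLeft_T₁, TensorProduct.assoc_tmul, LinearMap.lTensor_tmul]
    induction h.T₁ (q ⊗ₜ c) with
    | zero => simp
    | add x y hx hy => simp only [map_add, TensorProduct.tmul_add, hx, hy]
    | tmul r s => simp

end Galois

end IsCovered

/-! ### Cancelling a non-zero factor of a pure tensor over a field. -/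

section PureTensors

variable {k : Type*} [Field k] {V W : Type*} [AddCommGroup V] [Module k V] [AddCommGroup W]
  [Module k W]

theorem exists_linearForm_eq_one {v : V} (hv : v ≠ 0) : ∃ φ : V →ₗ[k] k, φ v = 1 := by
  obtain ⟨φ, hφ⟩ : ∃ φ : V →ₗ[k] k, φ v ≠ 0 := by
    by_contra! H
    exact hv ((Module.forall_dual_apply_eq_zero_iff k v).1 H)
  exact ⟨(φ v)⁻¹ • φ, by simp [hφ]⟩

theorem tmul_left_injective_of_ne_zero {v : V} (hv : v ≠ 0) {w w' : W}
    (h : v ⊗ₜ[k] w = v ⊗ₜ[k] w') : w = w' := by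
  obtain ⟨φ, hφ⟩ := exists_linearForm_eq_one (k := k) hv
  simpa [hφ] using congrArg (fun t => TensorProduct.lid k W (φ.rTensor W t)) h

theorem tmul_right_injective_of_ne_zero {w : W} (hw : w ≠ 0) {v v' : V}
    (h : v ⊗ₜ[k] w = v' ⊗ₜ[k] w) : v = v' := by
  obtain ⟨φ, hφ⟩ := exists_linearForm_eq_one (k := k) hw
  simpa [hφ] using congrArg (fun t => TensorProduct.rid k V (φ.lTensor V t)) h

end PureTensors

/-! ### Construction and properties of the counit. -/

namespace IsMultiplierHopfAlgebra

variable {k : Type*} [Field k]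
variable {A : Type*} [NonUnitalRing A] [Module k A] [IsScalarTower k A A] [SMulCommClass k A A]
variable [Nondegenerate A]
variable {Δ : A →ₙₐ[k] MultiplierAlgebra k (A ⊗[k] A)}

/-- The map `T₁` as a linear equivalence. -/
noncomputable def equiv₁ (h : IsMultiplierHopfAlgebra Δ) : A ⊗[k] A ≃ₗ[k] A ⊗[k] A :=
  LinearEquiv.ofBijective h.covered.T₁ h.bijective_T₁

/-- The map `T₂` as a linear equivalence. -/
noncomputable def equiv₂ (h : IsMultiplierHopfAlgebra Δ) : A ⊗[k] A ≃ₗ[k] A ⊗[k] A :=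
  LinearEquiv.ofBijective h.covered.T₂ h.bijective_T₂

/-- The map `μ ∘ T₁⁻¹`, where `μ` is the multiplication. -/
noncomputable def mulInv₁ (h : IsMultiplierHopfAlgebra Δ) : A ⊗[k] A →ₗ[k] A :=
  LinearMap.mul' k A ∘ₗ h.equiv₁.symm.toLinearMap

/-- The map `μ ∘ T₂⁻¹`, where `μ` is the multiplication. -/
noncomputable def mulInv₂ (h : IsMultiplierHopfAlgebra Δ) : A ⊗[k] A →ₗ[k] A :=
  LinearMap.mul' k A ∘ₗ h.equiv₂.symm.toLinearMap

theorem mulInv₁_T₁ (h : IsMultiplierHopfAlgebra Δ) (u : A ⊗[k] A) :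
    h.mulInv₁ (h.covered.T₁ u) = LinearMap.mul' k A u :=
  congrArg (LinearMap.mul' k A) (h.equiv₁.symm_apply_apply u)

theorem mulInv₂_T₂ (h : IsMultiplierHopfAlgebra Δ) (u : A ⊗[k] A) :
    h.mulInv₂ (h.covered.T₂ u) = LinearMap.mul' k A u :=
  congrArg (LinearMap.mul' k A) (h.equiv₂.symm_apply_apply u)

theorem mulInv₁_comp_T₁ (h : IsMultiplierHopfAlgebra Δ) :
    h.mulInv₁ ∘ₗ h.covered.T₁ = LinearMap.mul' k A := LinearMap.ext h.mulInv₁_T₁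

theorem mulInv₂_comp_T₂ (h : IsMultiplierHopfAlgebra Δ) :
    h.mulInv₂ ∘ₗ h.covered.T₂ = LinearMap.mul' k A := LinearMap.ext h.mulInv₂_T₂

/-- Write `b ⊗ c = T₁ u`. Coassociativity moves `T₁` past `T₂`, where `μ T₁⁻¹` turns it into `μ`;
what remains is `(A ⊗ μ)(T₂ ⊗ A)(a ⊗ u) = (a ⊗ 1)T₁ u`. In Sweedler notation: `a b₁ ⊗ ε(b₂) c = ab ⊗
c`. -/
theorem lTensor_mulInv₁ (h : IsMultiplierHopfAlgebra Δ) (a b c : A) :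
    h.mulInv₁.lTensor A (TensorProduct.assoc k A A A (h.covered.T₂ (a ⊗ₜ b) ⊗ₜ c)) =
      (a * b) ⊗ₜ c := by
  have key : ∀ u : A ⊗[k] A,
      h.mulInv₁.lTensor A (TensorProduct.assoc k A A A (h.covered.T₂.rTensor A
        ((TensorProduct.assoc k A A A).symm (a ⊗ₜ h.covered.T₁ u)))) =
      (LinearMap.mulLeft k a).rTensor A (h.covered.T₁ u) := by
    intro u
    rw [← IsCovered.lTensor_mul_rTensor_T₂, ← h.mulInv₁_comp_T₁, LinearMap.lTensor_comp,
      LinearMap.comp_apply]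
    congr 1
    induction u with
    | zero => simp
    | add x y hx hy => simp only [map_add, TensorProduct.tmul_add, hx, hy]
    | tmul p q => rw [h.coassociative.comm]; rfl
  obtain ⟨u, hu⟩ := h.bijective_T₁.2 (b ⊗ₜ c)
  simpa [hu] using key u

theorem rTensor_mulInv₂ (h : IsMultiplierHopfAlgebra Δ) (a b c : A) :
    h.mulInv₂.rTensor A ((TensorProduct.assoc k A A A).symm (a ⊗ₜ h.covered.T₁ (b ⊗ₜ c))) =
      a ⊗ₜ (b * c) := by
  have key : ∀ w : A ⊗[k] A,
      h.mulInv₂.rTensor A ((TensorProduct.assoc k A A A).symm (h.covered.T₁.lTensor A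
        (TensorProduct.assoc k A A A (h.covered.T₂ w ⊗ₜ c)))) =
      (LinearMap.mulRight k c).lTensor A (h.covered.T₂ w) := by
    intro w
    rw [← IsCovered.rTensor_mul_lTensor_T₁, ← h.mulInv₂_comp_T₂, LinearMap.rTensor_comp,
      LinearMap.comp_apply]
    congr 1
    rw [LinearEquiv.symm_apply_eq]
    induction w with
    | zero => simp
    | add x y hx hy => simp only [map_add, TensorProduct.add_tmul, hx, hy]
    | tmul p q => rw [← h.coassociative.comm]; rfl
  obtain ⟨w, hw⟩ := h.bijective_T₂.2 (a ⊗ₜ b)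
  simpa [hw] using key w

/-- By `lTensor_mulInv₁`, `A ⊗ μT₁⁻¹` sends `T₂ w ⊗ c` to `μ(w) ⊗ c`, and so does `μT₂⁻¹ ⊗ A`. As
`T₂` is surjective, the two maps agree everywhere. This is what forces both to be given by one
linear form. -/
theorem tmul_mulInv₁ (h : IsMultiplierHopfAlgebra Δ) (a b c : A) :
    a ⊗ₜ[k] h.mulInv₁ (b ⊗ₜ c) = h.mulInv₂ (a ⊗ₜ b) ⊗ₜ c := by
  have key : ∀ w : A ⊗[k] A,
      h.mulInv₁.lTensor A (TensorProduct.assoc k A A A (h.covered.T₂ w ⊗ₜ c)) =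
        h.mulInv₂ (h.covered.T₂ w) ⊗ₜ c := by
    intro w
    rw [mulInv₂_T₂]
    induction w with
    | zero => simp
    | add x y hx hy => simp only [map_add, TensorProduct.add_tmul, hx, hy]
    | tmul p q => rw [lTensor_mulInv₁]; rfl
  obtain ⟨w, hw⟩ := h.bijective_T₂.2 (a ⊗ₜ b)
  simpa [hw] using key w

/-- The counit of a multiplier Hopf algebra as a linear form. -/
theorem exists_counit [Nontrivial A] (h : IsMultiplierHopfAlgebra Δ) :
    ∃ ε : A →ₗ[k] k, (∀ a b, h.mulInv₁ (a ⊗ₜ b) = ε a • b) ∧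
      ∀ a b, h.mulInv₂ (a ⊗ₜ b) = ε b • a := by
  obtain ⟨x, hx⟩ := exists_ne (0 : A)
  obtain ⟨φ, hφ⟩ := exists_linearForm_eq_one (k := k) hx
  -- Applying `φ ⊗ A` to `x ⊗ μT₁⁻¹(a ⊗ b) = μT₂⁻¹(x ⊗ a) ⊗ b` isolates the scalar `ε(a) = φ(μT₂⁻¹(x
  -- ⊗ a))`.
  have h₁ : ∀ a b, h.mulInv₁ (a ⊗ₜ b) = φ (h.mulInv₂ (x ⊗ₜ a)) • b := by
    intro a b
    simpa [hφ] using
      congrArg (fun t => TensorProduct.lid k A (φ.rTensor A t)) (h.tmul_mulInv₁ x a b)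
  refine ⟨φ ∘ₗ h.mulInv₂ ∘ₗ TensorProduct.mk k A A x, h₁, fun a b => ?_⟩
  -- The same form serves for `T₂`: `μT₂⁻¹(a ⊗ b) ⊗ x = a ⊗ μT₁⁻¹(b ⊗ x) = a ⊗ ε(b)x`, and `x`
  -- cancels.
  refine tmul_right_injective_of_ne_zero (k := k) hx ?_
  rw [← tmul_mulInv₁, h₁, ← TensorProduct.smul_tmul]
  rfl

section Counit

variable {ε : A →ₗ[k] k}

/-- This is `rTensor_mulInv₂` with `μT₂⁻¹` replaced by `ε`, after cancelling an auxiliary non-zero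
first leg `x`. -/
theorem rTensor_counit_T₁ [Nontrivial A] (h : IsMultiplierHopfAlgebra Δ)
    (hε : ∀ a b, h.mulInv₂ (a ⊗ₜ b) = ε b • a) (a b : A) :
    TensorProduct.lid k A (ε.rTensor A (h.covered.T₁ (a ⊗ₜ b))) = a * b := by
  obtain ⟨x, hx⟩ := exists_ne (0 : A)
  refine tmul_left_injective_of_ne_zero (k := k) hx ?_
  rw [← h.rTensor_mulInv₂ x a b]
  induction h.covered.T₁ (a ⊗ₜ b) with
  | zero => simp
  | add x y hx hy => simp only [map_add, TensorProduct.tmul_add, hx, hy]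
  | tmul p q => simp [hε, TensorProduct.smul_tmul]

theorem lTensor_counit_T₂ [Nontrivial A] (h : IsMultiplierHopfAlgebra Δ)
    (hε : ∀ a b, h.mulInv₁ (a ⊗ₜ b) = ε a • b) (a b : A) :
    TensorProduct.rid k A (ε.lTensor A (h.covered.T₂ (a ⊗ₜ b))) = a * b := by
  obtain ⟨x, hx⟩ := exists_ne (0 : A)
  refine tmul_right_injective_of_ne_zero (k := k) hx ?_
  rw [← h.lTensor_mulInv₁ a b x]
  induction h.covered.T₂ (a ⊗ₜ b) with
  | zero => simp
  | add x y hx hy => simp only [map_add, TensorProduct.add_tmul, hx, hy]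
  | tmul p q => simp [hε, TensorProduct.smul_tmul]

theorem exists_mul_ne_zero [Nontrivial A] : ∃ a b : A, a * b ≠ 0 := by
  obtain ⟨x, hx⟩ := exists_ne (0 : A)
  by_contra! H
  exact hx (Nondegenerate.eq_zero_of_mul_right x (H x))

/-- If `ε` were zero, `ab = (ε ⊗ A)T₁(a ⊗ b)` would vanish for all `a`, `b`, against non-degeneracy.
-/
theorem counit_surjective [Nontrivial A] (h : IsMultiplierHopfAlgebra Δ)
    (hε : ∀ a b, h.mulInv₂ (a ⊗ₜ b) = ε b • a) : Function.Surjective ε := by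
  refine LinearMap.surjective fun h0 => ?_
  obtain ⟨a, b, hab⟩ := exists_mul_ne_zero (A := A)
  apply hab
  rw [← h.rTensor_counit_T₁ hε, h0]
  simp

theorem idempotent (h : IsMultiplierHopfAlgebra Δ)
    (hε : ∀ a b, h.mulInv₁ (a ⊗ₜ b) = ε a • b) (hs : Function.Surjective ε) : Idempotent k A where
  mul_surjective b := by
    obtain ⟨a, ha⟩ := hs 1
    -- With `ε(a) = 1`, the element `T₁⁻¹(a ⊗ b)` is a preimage of `ε(a)b = b` under `μ`.
    exact ⟨h.equiv₁.symm (a ⊗ₜ b), (hε a b).trans (by rw [ha, one_smul])⟩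

theorem T₁_mul_left (h : IsMultiplierHopfAlgebra Δ) (a : A) (t : A ⊗[k] A) :
    h.covered.T₁ ((LinearMap.mulLeft k a).rTensor A t) = (Δ a).left (h.covered.T₁ t) := by
  induction t with
  | zero => simp
  | add x y hx hy => simp only [map_add, hx, hy]
  | tmul b c =>
    apply ι_injective (k := k)
    rw [ι_left, LinearMap.rTensor_tmul, h.covered.ι_T₁, h.covered.ι_T₁, LinearMap.mulLeft_apply,
      map_mul, mul_assoc]

/-- The left counit law in a form that needs no extension to multipliers. Since `Δ(a)T₁(b ⊗ c) =
T₁(ab ⊗ c)` and `T₁` is surjective, it reduces to `(ab)c = a(bc)`. -/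
theorem rTensor_counit_left_comul [Nontrivial A] (h : IsMultiplierHopfAlgebra Δ)
    (hε : ∀ a b, h.mulInv₂ (a ⊗ₜ b) = ε b • a) (a : A) (t : A ⊗[k] A) :
    TensorProduct.lid k A (ε.rTensor A ((Δ a).left t)) =
      a * TensorProduct.lid k A (ε.rTensor A t) := by
  obtain ⟨u, rfl⟩ := h.bijective_T₁.2 t
  rw [← h.T₁_mul_left]
  induction u with
  | zero => simp
  | add x y hx hy => simp only [map_add, mul_add, hx, hy]
  | tmul b c =>
    rw [LinearMap.rTensor_tmul, h.rTensor_counit_T₁ hε, h.rTensor_counit_T₁ hε,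
      LinearMap.mulLeft_apply, mul_assoc]

theorem counit_mul [Nontrivial A] (h : IsMultiplierHopfAlgebra Δ)
    (hε : ∀ a b, h.mulInv₂ (a ⊗ₜ b) = ε b • a) (a b : A) : ε (a * b) = ε a * ε b := by
  -- For `t = T₁(x ⊗ y)` the product is `Δ(x)(b ⊗ yc)`, which `ε ⊗ A` sends to `ε(b)xyc`.
  have key : ∀ (t : A ⊗[k] A) (c : A), TensorProduct.lid k A (ε.rTensor A (t * b ⊗ₜ c)) =
      ε b • (TensorProduct.lid k A (ε.rTensor A t) * c) := by
    intro t c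
    obtain ⟨u, rfl⟩ := h.bijective_T₁.2 t
    induction u with
    | zero => simp
    | add x y hx hy => simp only [map_add, add_mul, smul_add, hx, hy]
    | tmul x y =>
      rw [h.covered.T₁_mul, h.rTensor_counit_left_comul hε, h.rTensor_counit_T₁ hε]
      simp [mul_assoc, mul_smul_comm]
  obtain ⟨x, y, hxy⟩ := exists_mul_ne_zero (A := A)
  -- This reads `ε(ab)xy = ε(b)ε(a)xy`, where `xy ≠ 0` can be cancelled.
  have h1 := key (a ⊗ₜ x) y
  simp only [Algebra.TensorProduct.tmul_mul_tmul, LinearMap.rTensor_tmul, TensorProduct.lid_tmul,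
    smul_mul_assoc, smul_smul] at h1
  rw [smul_left_injective k hxy h1, mul_comm]

/-- Not a mirror image of `rTensor_counit_left_comul`: here `Δ(a)` acts from the left, while `T₂`
carries `Δ` on the right. So one multiplies by `x` on the left, writes `(x ⊗ 1)Δ(a)t = T₂(x ⊗ a)t`,
and uses that `A ⊗ ε` is multiplicative; non-degeneracy removes `x`. -/
theorem lTensor_counit_left_comul [Nontrivial A] (h : IsMultiplierHopfAlgebra Δ)
    (hε₁ : ∀ a b, h.mulInv₁ (a ⊗ₜ b) = ε a • b) (hε₂ : ∀ a b, h.mulInv₂ (a ⊗ₜ b) = ε b • a)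
    (a : A) (t : A ⊗[k] A) :
    TensorProduct.rid k A (ε.lTensor A ((Δ a).left t)) =
      a * TensorProduct.rid k A (ε.lTensor A t) := by
  have hmul : ∀ s t : A ⊗[k] A, TensorProduct.rid k A (ε.lTensor A (s * t)) =
      TensorProduct.rid k A (ε.lTensor A s) * TensorProduct.rid k A (ε.lTensor A t) := by
    intro s t
    induction s with
    | zero => simp
    | add x y hx hy => simp only [map_add, add_mul, hx, hy]
    | tmul x y =>
      induction t with
      | zero => simp
      | add x y hx hy => simp only [map_add, mul_add, hx, hy]
      | tmul z w => simp [h.counit_mul hε₂, smul_mul_smul_comm]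
  have hleft : ∀ (x : A) (s : A ⊗[k] A),
      TensorProduct.rid k A (ε.lTensor A ((LinearMap.mulLeft k x).rTensor A s)) =
        x * TensorProduct.rid k A (ε.lTensor A s) := by
    intro x s
    induction s with
    | zero => simp
    | add x y hx hy => simp only [map_add, mul_add, hx, hy]
    | tmul y z => simp [mul_smul_comm]
  refine sub_eq_zero.1 (Nondegenerate.eq_zero_of_mul_left _ fun x => ?_)
  rw [mul_sub, ← hleft, ← h.covered.T₂_mul, hmul, h.lTensor_counit_T₂ hε₁, mul_assoc, sub_self]

end Counit

/-! ### Non-degeneracy of `Δ`. -/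

theorem isNondegenerateMap [Idempotent k A] (h : IsMultiplierHopfAlgebra Δ) :
    IsNondegenerateMap Δ where
  left_surjective := by
    rw [← LinearMap.range_eq_top, eq_top_iff]
    rintro c -
    obtain ⟨t, rfl⟩ := Idempotent.mul_surjective (k := k) c
    induction t with
    | zero => simp
    | add x y hx hy => rw [map_add]; exact add_mem hx hy
    | tmul s t =>
      rw [LinearMap.mul'_apply]
      -- `A ⊗ A` is spanned by products `st`, and for `s = T₁(a ⊗ b)` the product `s(x ⊗ y) = Δ(a)(x
      -- ⊗ by)` lies in `Δ(A) ▹ (A ⊗ A)`.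
      obtain ⟨u, rfl⟩ := h.bijective_T₁.2 s
      induction u with
      | zero => simp
      | add x y hx hy => rw [map_add, add_mul]; exact add_mem hx hy
      | tmul a b =>
        induction t with
        | zero => simp
        | add x y hx hy => rw [mul_add]; exact add_mem hx hy
        | tmul x y => exact ⟨a ⊗ₜ (x ⊗ₜ (b * y)), (h.covered.T₁_mul a b x y).symm⟩
  right_surjective := by
    rw [← LinearMap.range_eq_top, eq_top_iff]
    rintro c -
    obtain ⟨t, rfl⟩ := Idempotent.mul_surjective (k := k) c
    induction t with
    | zero => simp
    | add x y hx hy => rw [map_add]; exact add_mem hx hy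
    | tmul s t =>
      rw [LinearMap.mul'_apply]
      obtain ⟨u, rfl⟩ := h.bijective_T₂.2 t
      induction u with
      | zero => simp
      | add x y hx hy => rw [map_add, mul_add]; exact add_mem hx hy
      | tmul a b =>
        induction s with
        | zero => simp
        | add x y hx hy => rw [add_mul]; exact add_mem hx hy
        | tmul x y => exact ⟨((x * a) ⊗ₜ y) ⊗ₜ b, (h.covered.mul_T₂ a b x y).symm⟩

end IsMultiplierHopfAlgebra

/-! ### Separating multipliers of `A ⊗ A ⊗ A`. -/

section Separation

variable {k : Type*} [CommRing k]
variable {A : Type*} [NonUnitalRing A] [Module k A] [IsScalarTower k A A] [SMulCommClass k A A]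
variable [Nondegenerate A] [Module.Projective k A] [Idempotent k A]

/-- Multipliers `x` of `A ⊗ A ⊗ A` are determined by the products
`(a ⊗ 1 ⊗ 1) x (1 ⊗ 1 ⊗ c)`. -/
theorem ext_outer_mul {x y : MultiplierAlgebra k (A ⊗[k] (A ⊗[k] A))}
    (h : ∀ a c : A, Ψ k A (A ⊗[k] A) (ι k A a ⊗ₜ 1) * x *
        Ψ k A (A ⊗[k] A) (1 ⊗ₜ Ψ k A A (1 ⊗ₜ ι k A c)) =
      Ψ k A (A ⊗[k] A) (ι k A a ⊗ₜ 1) * y *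
        Ψ k A (A ⊗[k] A) (1 ⊗ₜ Ψ k A A (1 ⊗ₜ ι k A c))) : x = y := by
  have h₁ : ∀ a : A, Ψ k A (A ⊗[k] A) (ι k A a ⊗ₜ 1) * x =
      Ψ k A (A ⊗[k] A) (ι k A a ⊗ₜ 1) * y := by
    intro a
    refine MultiplierAlgebra.ext_left fun t => ?_
    induction t with
    | zero => simp
    | add t t' ht ht' => simp only [map_add, ht, ht']
    | tmul p t =>
      induction t with
      | zero => simp
      | add t t' ht ht' => simp only [map_add, TensorProduct.tmul_add, ht, ht']
      | tmul q r =>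
        -- Idempotency lets the last leg be written as a product `cr`, which supplies the factor `1
        -- ⊗ 1 ⊗ c`.
        obtain ⟨t, rfl⟩ := Idempotent.mul_surjective (k := k) r
        induction t with
        | zero => simp
        | add t t' ht ht' => simp only [map_add, TensorProduct.tmul_add, ht, ht']
        | tmul c r => exact congrArg (fun z => left z (p ⊗ₜ[k] (q ⊗ₜ[k] r))) (h a c)
  refine MultiplierAlgebra.ext_left fun t => sub_eq_zero.1 ?_
  -- Only the first leg has to be tested: left multiplications by all `a` are jointly injective
  -- there, and the identity alone suffices on the remaining two legs.
  refine eq_zero_of_map_eq_zero (fun a : A => LinearMap.mulLeft k a)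
    (fun _ : Unit => LinearMap.id) (fun p hp => Nondegenerate.eq_zero_of_mul_left p hp)
    (fun q hq => hq ()) _ fun a _ => ?_
  rw [map_sub, sub_eq_zero]
  exact congrArg (fun z => left z t) (h₁ a)

end Separation

/-! ### Extensions of tensor products of morphisms. -/

section Extension

variable {k : Type*} [CommRing k]
variable {A : Type*} [NonUnitalRing A] [Module k A] [IsScalarTower k A A] [SMulCommClass k A A]
variable {B : Type*} [NonUnitalRing B] [Module k B] [IsScalarTower k B B] [SMulCommClass k B B]
variable {C : Type*} [NonUnitalRing C] [Module k C] [IsScalarTower k C C] [SMulCommClass k C C]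
variable {D : Type*} [NonUnitalRing D] [Module k D] [IsScalarTower k D D] [SMulCommClass k D D]

/-- Needed to evaluate the extensions of `Δ ⊗ ι` and `ι ⊗ Δ` on the multipliers `1 ⊗ c` and `a ⊗ 1`,
which do not come from `A ⊗ A` in general. -/
theorem IsNondegenerateMap.extend_tensorMap_Ψ [Nondegenerate (A ⊗[k] C)] [Nondegenerate A]
    [Nondegenerate C] {f : B →ₙₐ[k] MultiplierAlgebra k A} {g : D →ₙₐ[k] MultiplierAlgebra k C}
    (hf : IsNondegenerateMap f) (hg : IsNondegenerateMap g)
    (x : MultiplierAlgebra k B) (y : MultiplierAlgebra k D) :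
    (hf.tensor hg).extend (Ψ k B D (x ⊗ₜ y)) = Ψ k A C (hf.extend x ⊗ₜ hg.extend y) := by
  refine (hf.tensor hg).ext_left fun b a => ?_
  rw [left_extend]
  induction b with
  | zero => simp
  | add b b' h h' => simp only [map_add, MultiplierAlgebra.left_add, h, h']
  | tmul b d =>
    induction a with
    | zero => simp
    | add a a' h h' => simp only [map_add, h, h']
    | tmul a c => simp

end Extension

/-! ### The comonoid axioms in `NdI k`. -/

namespace IsMultiplierHopfAlgebra

variable {k : Type u} [Field k]
variable {A : Type u} [NonUnitalRing A] [Module k A] [IsScalarTower k A A] [SMulCommClass k A A]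
variable [Nondegenerate A] [Idempotent k A]
variable {Δ : A →ₙₐ[k] MultiplierAlgebra k (A ⊗[k] A)}

/-- After sandwiching between `a ⊗ 1 ⊗ 1` and `1 ⊗ 1 ⊗ c`, the outer factors are absorbed into the
extensions, whose arguments become `Δ(b)(1 ⊗ c)` and `(a ⊗ 1)Δ(b)`. These lie in `A ⊗ A`, so the
hypothesis of coassociativity applies. -/
theorem coassoc_extend (h : IsMultiplierHopfAlgebra Δ)
    (hι : IsNondegenerateMap (ι k A)) (b : A) :
    transport (TensorProduct.assoc k A A A) NdI.assoc_mul
        ((h.isNondegenerateMap.tensor hι).extend (Δ b)) =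
      (hι.tensor h.isNondegenerateMap).extend (Δ b) := by
  have hι' : ∀ x : MultiplierAlgebra k A, hι.extend x = x := fun x =>
    hι.ext_left fun a r => by rw [hι.left_extend, left_ι, left_ι, left_apply_mul]
  have transport_tmul : ∀ x y z : MultiplierAlgebra k A,
      transport (TensorProduct.assoc k A A A) NdI.assoc_mul
        (Ψ k (A ⊗[k] A) A (Ψ k A A (x ⊗ₜ y) ⊗ₜ z)) =
        Ψ k A (A ⊗[k] A) (x ⊗ₜ Ψ k A A (y ⊗ₜ z)) := by
    intro x y z
    refine MultiplierAlgebra.ext_left fun t => ?_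
    induction t with
    | zero => simp
    | add t t' ht ht' => simp only [map_add, ht, ht']
    | tmul p t =>
      induction t with
      | zero => simp
      | add t t' ht ht' => simp only [map_add, TensorProduct.tmul_add, ht, ht']
      | tmul q r => simp [transport]
  have Ψ_one : Ψ k A A (1 ⊗ₜ 1) = 1 := map_one (Ψ k A A)
  refine ext_outer_mul fun a c => ?_
  have h₁ : Ψ k (A ⊗[k] A) A (Ψ k A A (ι k A a ⊗ₜ 1) ⊗ₜ 1) *
        (h.isNondegenerateMap.tensor hι).extend (Δ b) *
          Ψ k (A ⊗[k] A) A (1 ⊗ₜ ι k A c) =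
      Ψ k (A ⊗[k] A) A (Ψ k A A (ι k A a ⊗ₜ 1) ⊗ₜ 1) *
        tensorMap Δ (ι k A) (h.covered.T₁ (b ⊗ₜ c)) := by
    -- The extension of `Δ` is unital, so the extension of `Δ ⊗ ι` sends `1 ⊗ c` to `1 ⊗ 1 ⊗ c`.
    rw [← (h.isNondegenerateMap.tensor hι).extend_ι (h.covered.T₁ (b ⊗ₜ c)), h.covered.ι_T₁,
      map_mul, h.isNondegenerateMap.extend_tensorMap_Ψ hι, map_one, hι', mul_assoc]
  have h₂ : Ψ k A (A ⊗[k] A) (ι k A a ⊗ₜ 1) *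
        (hι.tensor h.isNondegenerateMap).extend (Δ b) =
      tensorMap (ι k A) Δ (h.covered.T₂ (a ⊗ₜ b)) := by
    rw [← (hι.tensor h.isNondegenerateMap).extend_ι (h.covered.T₂ (a ⊗ₜ b)), h.covered.ι_T₂,
      map_mul, hι.extend_tensorMap_Ψ h.isNondegenerateMap, map_one, hι']
  -- What is left is to rebracket the two outer factors, identifying `1 ⊗ 1` with the unit of `𝕄(A ⊗
  -- A)`.
  rw [h₂, ← h.coassociative, ← h₁, transport_mul, transport_mul, transport_tmul, Ψ_one,
    ← transport_tmul 1 1, Ψ_one]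

/-- The comultiplication of a multiplier Hopf algebra as a morphism of `NdI_k`. -/
def comulHom (h : IsMultiplierHopfAlgebra Δ) :
    NdI.Hom (NdI.mk (k := k) A) ((NdI.mk (k := k) A).tensor (NdI.mk (k := k) A)) :=
  ⟨Δ, h.isNondegenerateMap⟩

theorem comulHom_coassoc (h : IsMultiplierHopfAlgebra Δ) :
    NdI.Hom.comp h.comulHom (NdI.Hom.tensor (NdI.Hom.id _) h.comulHom) =
      NdI.Hom.comp h.comulHom (NdI.Hom.comp (NdI.Hom.tensor h.comulHom (NdI.Hom.id _))
        (NdI.assocIso _ _ _).hom) := by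
  rw [← NdI.Hom.assoc]
  symm
  -- The associator comes from an algebra isomorphism, so composing with it amounts to intertwining
  -- the left actions.
  refine NdI.Hom.comp_ofSurjective (he := (TensorProduct.assoc k A A A).surjective) fun b t => ?_
  change A at b
  change (A ⊗[k] A) ⊗[k] A at t
  have hι : IsNondegenerateMap (ι k A) := (NdI.Hom.id (NdI.mk (k := k) A)).isNondegenerate
  change TensorProduct.assoc k A A A (((h.isNondegenerateMap.tensor hι).extend (Δ b)).left t) =
    ((hι.tensor h.isNondegenerateMap).extend (Δ b)).left (TensorProduct.assoc k A A A t)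
  simp [← h.coassoc_extend hι b, transport]

variable {ε : A →ₙₐ[k] k} {hs : Function.Surjective ε}

/-- The counit of a multiplier Hopf algebra as a morphism of `NdI_k`. -/
def counitHom (ε : A →ₙₐ[k] k) (hs : Function.Surjective ε) :
    NdI.Hom (NdI.mk (k := k) A) (NdI.unit k) :=
  NdI.Hom.ofSurjective (B := NdI.mk (k := k) A) (A := NdI.unit k) ε hs

theorem counitHom_comulHom (h : IsMultiplierHopfAlgebra Δ)
    (H : ∀ (a : A) (t : A ⊗[k] A),
      TensorProduct.lid k A ((ε : A →ₗ[k] k).rTensor A ((Δ a).left t)) =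
        a * TensorProduct.lid k A ((ε : A →ₗ[k] k).rTensor A t)) :
    NdI.Hom.comp h.comulHom (NdI.Hom.tensor (counitHom ε hs) (NdI.Hom.id _)) =
      (NdI.lidIso (NdI.mk (k := k) A)).inv := by
  -- Under `k ⊗ A ≅ A`, the multiplier `(ε ⊗ ι)(s)` acts as left multiplication by `(ε ⊗ A)(s)`, so
  -- the counit law becomes the hypothesis `H`.
  have key : ∀ (s : A ⊗[k] A) (r : k ⊗[k] A), TensorProduct.lid k A
      ((tensorMap ((ι k k).comp ε) (ι k A) s).left r) =
        TensorProduct.lid k A ((ε : A →ₗ[k] k).rTensor A s) * TensorProduct.lid k A r := by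
    intro s r
    induction s with
    | zero => simp
    | add x y hx hy => simp only [map_add, MultiplierAlgebra.left_add, add_mul, hx, hy]
    | tmul x y =>
      induction r with
      | zero => simp
      | add x y hx hy => simp only [map_add, mul_add, hx, hy]
      | tmul c z => simp [smul_mul_smul_comm]
  refine NdI.Hom.comp_eq_of_left fun b t r => ?_
  change A at b
  change A ⊗[k] A at t
  change k ⊗[k] A at r
  change (tensorMap ((ι k k).comp ε) (ι k A) ((Δ b).left t)).left r =
    (TensorProduct.lid k A).symm b * (tensorMap ((ι k k).comp ε) (ι k A) t).left r
  apply (TensorProduct.lid k A).injective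
  rw [key, H, NdI.lid_mul, key, LinearEquiv.apply_symm_apply, mul_assoc]

theorem comulHom_counitHom (h : IsMultiplierHopfAlgebra Δ)
    (H : ∀ (a : A) (t : A ⊗[k] A),
      TensorProduct.rid k A ((ε : A →ₗ[k] k).lTensor A ((Δ a).left t)) =
        a * TensorProduct.rid k A ((ε : A →ₗ[k] k).lTensor A t)) :
    NdI.Hom.comp h.comulHom (NdI.Hom.tensor (NdI.Hom.id _) (counitHom ε hs)) =
      (NdI.ridIso (NdI.mk (k := k) A)).inv := by
  have key : ∀ (s : A ⊗[k] A) (r : A ⊗[k] k), TensorProduct.rid k A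
      ((tensorMap (ι k A) ((ι k k).comp ε) s).left r) =
        TensorProduct.rid k A ((ε : A →ₗ[k] k).lTensor A s) * TensorProduct.rid k A r := by
    intro s r
    induction s with
    | zero => simp
    | add x y hx hy => simp only [map_add, MultiplierAlgebra.left_add, add_mul, hx, hy]
    | tmul x y =>
      induction r with
      | zero => simp
      | add x y hx hy => simp only [map_add, mul_add, hx, hy]
      | tmul z c => simp [smul_mul_smul_comm]
  refine NdI.Hom.comp_eq_of_left fun b t r => ?_
  change A at b
  change A ⊗[k] A at t
  change A ⊗[k] k at r
  change (tensorMap (ι k A) ((ι k k).comp ε) ((Δ b).left t)).left r =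
    (TensorProduct.rid k A).symm b * (tensorMap (ι k A) ((ι k k).comp ε) t).left r
  apply (TensorProduct.rid k A).injective
  rw [key, H, NdI.rid_mul, key, LinearEquiv.apply_symm_apply, mul_assoc]

end IsMultiplierHopfAlgebra

end MultHopf

theorem proposition3p1 (k : Type u) [Field k] (A : Type u) [NonUnitalRing A] [Module k A]
    [IsScalarTower k A A] [SMulCommClass k A A] [MultHopf.Nondegenerate A] [Nontrivial A]
    (Δ : A →ₙₐ[k] MultHopf.MultiplierAlgebra k (A ⊗[k] A))
    (hΔ : MultHopf.IsMultiplierHopfAlgebra Δ) :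
    ∃ _ : MultHopf.Idempotent k A,
      ∃ c : ComonObj (MultHopf.NdI.mk (k := k) A), c.comul.toMap = Δ := by
  obtain ⟨ε, hε₁, hε₂⟩ := hΔ.exists_counit
  have hs := hΔ.counit_surjective hε₂
  have : MultHopf.Idempotent k A := hΔ.idempotent hε₁ hs
  -- Multiplicativity makes `ε` an algebra map, and its surjectivity onto `k` makes that map a
  -- morphism of `NdI k`.
  let ε' : A →ₙₐ[k] k :=
    { ε with
      map_smul' := ε.map_smul
      map_zero' := ε.map_zero
      map_mul' := hΔ.counit_mul hε₂ }
  exact ⟨this,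
    { counit := MultHopf.IsMultiplierHopfAlgebra.counitHom ε' hs
      comul := hΔ.comulHom
      counit_comul := hΔ.counitHom_comulHom (hΔ.rTensor_counit_left_comul hε₂)
      comul_counit := hΔ.comulHom_counitHom (hΔ.lTensor_counit_left_comul hε₁ hε₂)
      comul_assoc := hΔ.comulHom_coassoc }, rfl⟩
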